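/- Let $\mathbb K\in\{\mathbb R,\mathbb C\}$ and let $\Gamma=(V,E,a,b,\gamma_0,\gamma_1)$ be a metric graph: $V$ (vertices) and $E$ (edges) are arbitrary sets (possibly uncountable, with vertices of infinite degree allowed), $a,b\colon E\to[-\infty,\infty]$ satisfy $a_e<b_e$ for all $e\in E$, the interval $(a_e,b_e)\subseteq\mathbb R$ corresponds to the edge $e$, and $\gamma_0\colon E_l:=\{e: a_e>-\infty\}\to V$ and $\gamma_1\colon E_r:=\{e: b_e<\infty\}\to V$ assign starting and end vertices. Assume that the edge lengths have a positive lower bound, $\inf_{e\in E}(b_e-a_e)>0$. Let $\mathcal H:=\bigoplus_{e\in E}L_2(a_e,b_e)$ (Hilbert space direct sum). For $k\in\{1,2\}$ let $\bigoplus_{e\in E}W_2^k(a_e,b_e)$ be the space of all $f=(f_e)_{e\in E}\in\mathcal H$ whose edgewise weak derivatives up to order $k$ exist and again form elements of $\mathcal H$, and write $f'=(f_e')_{e\in E}$. Let $E':=(E_l\times\{0\})\cup(E_r\times\{1\})$ be the set of finite boundary points of all edges. The trace and the signed trace are the linear maps $\operatorname{tr},\operatorname{str}\colon\bigoplus_{e\in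 E}W_2^1(a_e,b_e)\to\ell_2(E')$, $$(\operatorname{tr}f)(e,0)=f_e(a_e),\quad(\operatorname{tr}f)(e,1)=f_e(b_e),\qquad(\operatorname{str}f)(e,0)=f_e(a_e),\quad(\operatorname{str}f)(e,1)=-f_e(b_e),$$ where the boundary values are those of the continuous representatives. Let $\hat H$ be the maximal Laplacian in $\mathcal H$, $D(\hat H):=\bigoplus_{e\in E}W_2^2(a_e,b_e)$, $\hat Hf:=(-f_e'')_{e\in E}$. **Theorem.** A linear operator $H\subseteq\hat H$ (a restriction of $\hat H$ to a linear subspace of $D(\hat H)$) is self-adjoint in $\mathcal H$ if and only if there exist a closed subspace $X\subseteq\ell_2(E')$ and a (possibly unbounded) self-adjoint operator $L$ in $X$ such that $$D(H)=\{f\in D(\hat H):\ \operatorname{tr}f\in D(L),\ L\operatorname{tr}f=Q\operatorname{str}f'\},$$ where $Q\colon\ell_2(E')\to X$ is the orthogonal projection. No semiboundedness of $H$ or $L$ is assumed. -/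

import Mathlib

namespace QuantumGraph

open MeasureTheory Set
open scoped ENNReal ContDiff

section Edge
variable {𝕜 : Type*} [RCLike 𝕜] {I : Set ℝ}

/-- `g ∈ L₂(I)` is the weak (distributional) derivative of `f ∈ L₂(I)` on the open set `I ⊆ ℝ`:
`∫ f φ' = -∫ g φ` for every test function `φ ∈ C_c^∞(I)`. -/
def IsWeakDeriv (I : Set ℝ) (f g : Lp 𝕜 2 (volume.restrict I)) : Prop :=
  ∀ φ : ℝ → ℝ, ContDiff ℝ ∞ φ → HasCompactSupport φ → tsupport φ ⊆ I →
    ∫ x in I, deriv φ x • f x = -∫ x in I, φ x • g x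

open Classical in
/-- The value at `x ∈ closure I` of the representative of `f` that is continuous on `closure I`.
Such a representative exists if `I` is an open interval and `f ∈ W_2^1(I)` (see
`IsWeakDeriv.exists_continuous`), and its value is unique (see `boundaryValue_eq`);
the value `0` is assigned if there is none. -/
noncomputable def boundaryValue (I : Set ℝ) (f : Lp 𝕜 2 (volume.restrict I)) (x : ℝ) : 𝕜 :=
  if h : ∃ F : ℝ → 𝕜, ContinuousOn F (closure I) ∧ F =ᵐ[volume.restrict I] f then h.choose x else 0

theorem boundaryValue_eq (hI : IsOpen I) {f : Lp 𝕜 2 (volume.restrict I)} {F : ℝ → 𝕜}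
    (hF : ContinuousOn F (closure I)) (hf : F =ᵐ[volume.restrict I] f) {x : ℝ}
    (hx : x ∈ closure I) : boundaryValue I f x = F x := by
  have h : ∃ F : ℝ → 𝕜, ContinuousOn F (closure I) ∧ F =ᵐ[volume.restrict I] f := ⟨F, hF, hf⟩
  rw [boundaryValue, dif_pos h]
  have h1 := Measure.eqOn_open_of_ae_eq (h.choose_spec.2.trans hf.symm) hI
    (h.choose_spec.1.mono subset_closure) (hF.mono subset_closure)
  exact h1.of_subset_closure h.choose_spec.1 hF subset_closure subset_rfl hx

theorem integrable_test_smul {φ : ℝ → ℝ} (hφ : Continuous φ) (hc : HasCompactSupport φ)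
    (f : Lp 𝕜 2 (volume.restrict I)) :
    Integrable (fun x => φ x • f x) (volume.restrict I) := by
  have h1 : MemLp φ 2 (volume.restrict I) := (hφ.memLp_of_hasCompactSupport hc).restrict I
  exact memLp_one_iff_integrable.1 ((Lp.memLp f).smul (p := 2) (q := 2) (r := 1) h1)

theorem IsWeakDeriv.add {f g f' g' : Lp 𝕜 2 (volume.restrict I)} (h : IsWeakDeriv I f g)
    (h' : IsWeakDeriv I f' g') : IsWeakDeriv I (f + f') (g + g') := by
  intro φ h1 h2 h3
  have hd : Continuous (deriv φ) := h1.continuous_deriv (by simp)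
  have e1 : ∫ x in I, deriv φ x • (f + f') x
      = ∫ x in I, (deriv φ x • f x + deriv φ x • f' x) := by
    refine integral_congr_ae ?_
    filter_upwards [Lp.coeFn_add f f'] with x hx
    rw [hx, Pi.add_apply, smul_add]
  have e2 : ∫ x in I, φ x • (g + g') x = ∫ x in I, (φ x • g x + φ x • g' x) := by
    refine integral_congr_ae ?_
    filter_upwards [Lp.coeFn_add g g'] with x hx
    rw [hx, Pi.add_apply, smul_add]
  rw [e1, e2, integral_add (integrable_test_smul hd h2.deriv f)
    (integrable_test_smul hd h2.deriv f'), integral_add (integrable_test_smul h1.continuous h2 g)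
    (integrable_test_smul h1.continuous h2 g'), h φ h1 h2 h3, h' φ h1 h2 h3]
  ring

theorem IsWeakDeriv.smul {f g : Lp 𝕜 2 (volume.restrict I)} (c : 𝕜) (h : IsWeakDeriv I f g) :
    IsWeakDeriv I (c • f) (c • g) := by
  intro φ h1 h2 h3
  have e1 : ∫ x in I, deriv φ x • (c • f) x = ∫ x in I, c • (deriv φ x • f x) := by
    refine integral_congr_ae ?_
    filter_upwards [Lp.coeFn_smul c f] with x hx
    rw [hx, Pi.smul_apply, smul_comm]
  have e2 : ∫ x in I, φ x • (c • g) x = ∫ x in I, c • (φ x • g x) := by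
    refine integral_congr_ae ?_
    filter_upwards [Lp.coeFn_smul c g] with x hx
    rw [hx, Pi.smul_apply, smul_comm]
  rw [e1, e2, integral_smul, integral_smul, h φ h1 h2 h3, smul_neg]

theorem locInt (f : Lp 𝕜 2 (volume.restrict I)) (hI : MeasurableSet I) :
    LocallyIntegrable (I.indicator f) volume :=
  ((memLp_indicator_iff_restrict hI).2 (Lp.memLp f)).locallyIntegrable (by norm_num)

theorem IsWeakDeriv.unique (hI : IsOpen I) {f g g' : Lp 𝕜 2 (volume.restrict I)}
    (h : IsWeakDeriv I f g) (h' : IsWeakDeriv I f g') : g = g' := by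
  have key := hI.ae_eq_zero_of_integral_contDiff_smul_eq_zero (μ := volume)
    (f := I.indicator (g - g' : Lp 𝕜 2 (volume.restrict I)))
    ((locInt _ hI.measurableSet).locallyIntegrableOn I) (fun φ h1 h2 h3 => by
      have e : ∀ x, φ x • I.indicator (g - g' : Lp 𝕜 2 (volume.restrict I)) x
          = I.indicator (fun x => φ x • (g - g' : Lp 𝕜 2 (volume.restrict I)) x) x := by
        intro x; by_cases hx : x ∈ I <;> simp [hx]
      simp_rw [e]
      rw [integral_indicator hI.measurableSet]
      have e2 : ∫ x in I, φ x • (g - g' : Lp 𝕜 2 (volume.restrict I)) x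
          = ∫ x in I, (φ x • g x - φ x • g' x) := by
        refine integral_congr_ae ?_
        filter_upwards [Lp.coeFn_sub g g'] with x hx
        rw [hx, Pi.sub_apply, smul_sub]
      rw [e2, integral_sub (integrable_test_smul h1.continuous h2 g)
        (integrable_test_smul h1.continuous h2 g')]
      have := (h φ h1 h2 h3).symm.trans (h' φ h1 h2 h3)
      rw [neg_inj.1 this, sub_self])
  apply sub_eq_zero.1
  refine (Lp.eq_zero_iff_ae_eq_zero).2 ?_
  rw [Filter.EventuallyEq, ae_restrict_iff' hI.measurableSet]
  filter_upwards [key] with x hx hxI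
  simpa [hxI] using hx hxI

theorem by_parts_real {g : ℝ → ℝ} (hg : LocallyIntegrable g volume) {φ : ℝ → ℝ}
    (h1 : ContDiff ℝ ∞ φ) (h2 : HasCompactSupport φ) :
    ∫ x, deriv φ x * (∫ t in (0 : ℝ)..x, g t) = -∫ x, φ x * g x := by
  obtain ⟨R, hR, hsub⟩ : ∃ R : ℝ, 0 < R ∧ tsupport φ ⊆ Ioo (-R) R := by
    obtain ⟨r, hr⟩ := h2.isCompact.isBounded.subset_ball (0 : ℝ)
    refine ⟨max r 1, by positivity, hr.trans ?_⟩
    rw [Real.ball_eq_Ioo]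
    exact Ioo_subset_Ioo (by have := le_max_left r 1; linarith) (by simp)
  have hle : -R ≤ R := by linarith
  have hgi : ∀ a b : ℝ, IntervalIntegrable g volume a b := fun a b =>
    (hg.integrableOn_isCompact isCompact_uIcc).intervalIntegrable
  have acF : AbsolutelyContinuousOnInterval (fun x => ∫ t in (0 : ℝ)..x, g t) (-R) R :=
    (hgi _ _).absolutelyContinuousOnInterval_intervalIntegral
      (by rw [uIcc_of_le hle]; constructor <;> linarith)
  have acφ : AbsolutelyContinuousOnInterval φ (-R) R :=
    (h1.of_le (by simp)).contDiffOn.absolutelyContinuousOnInterval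
  have zR : φ R = 0 := image_eq_zero_of_notMem_tsupport fun h => absurd (hsub h).2 (lt_irrefl _)
  have zR' : φ (-R) = 0 :=
    image_eq_zero_of_notMem_tsupport fun h => absurd (hsub h).1 (lt_irrefl _)
  have key := acφ.integral_mul_deriv_eq_deriv_mul acF
  rw [zR, zR'] at key
  have e1 : ∫ x in (-R)..R, φ x * deriv (fun x => ∫ t in (0 : ℝ)..x, g t) x
      = ∫ x in (-R)..R, φ x * g x := by
    apply intervalIntegral.integral_congr_ae
    filter_upwards [(hgi (-R) R).ae_hasDerivAt_integral] with x hx hx'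
    rw [(hx (uIoc_subset_uIcc hx') 0
      (by rw [uIcc_of_le hle]; constructor <;> linarith)).deriv]
  rw [e1] at key
  have s1 : ∫ x in (-R)..R, φ x * g x = ∫ x, φ x * g x := by
    apply intervalIntegral.integral_eq_integral_of_support_subset
    intro x hx
    have : x ∈ tsupport φ := subset_tsupport _ (left_ne_zero_of_mul hx)
    exact Ioo_subset_Ioc_self (hsub this)
  have s2 : ∫ x in (-R)..R, deriv φ x * (∫ t in (0 : ℝ)..x, g t)
      = ∫ x, deriv φ x * (∫ t in (0 : ℝ)..x, g t) := by
    apply intervalIntegral.integral_eq_integral_of_support_subset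
    intro x hx
    have : x ∈ tsupport φ := support_deriv_subset (left_ne_zero_of_mul hx)
    exact Ioo_subset_Ioc_self (hsub this)
  rw [s1, s2] at key
  linarith

theorem by_parts {g : ℝ → 𝕜} (hg : LocallyIntegrable g volume) {φ : ℝ → ℝ}
    (h1 : ContDiff ℝ ∞ φ) (h2 : HasCompactSupport φ) :
    ∫ x, deriv φ x • (∫ t in (0 : ℝ)..x, g t) = -∫ x, φ x • g x := by
  have hd : Continuous (deriv φ) := h1.continuous_deriv (by simp)
  have hgi : ∀ a b : ℝ, IntervalIntegrable g volume a b := fun a b =>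
    (hg.integrableOn_isCompact isCompact_uIcc).intervalIntegrable
  have hcF : Continuous (fun x => ∫ t in (0 : ℝ)..x, g t) :=
    intervalIntegral.continuous_primitive hgi 0
  have i1 : Integrable (fun x => deriv φ x • (∫ t in (0 : ℝ)..x, g t)) volume :=
    (hd.smul hcF).integrable_of_hasCompactSupport h2.deriv.smul_right
  have i2 : Integrable (fun x => φ x • g x) volume :=
    hg.integrable_smul_left_of_hasCompactSupport h1.continuous h2
  have main : ∀ A : 𝕜 →L[ℝ] ℝ, A (∫ x, deriv φ x • (∫ t in (0 : ℝ)..x, g t))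
      = A (-∫ x, φ x • g x) := by
    intro A
    have hA : LocallyIntegrable (fun x => A (g x)) volume := fun x => by
      obtain ⟨s, hs, hi⟩ := hg x
      exact ⟨s, hs, A.integrable_comp hi⟩
    rw [map_neg, ← A.integral_comp_comm i1, ← A.integral_comp_comm i2]
    have := by_parts_real hA h1 h2
    simp only [map_smul, smul_eq_mul]
    rw [← this]
    congr 1
    ext x
    rw [A.intervalIntegral_comp_comm (hgi 0 x)]
  exact RCLike.ext (main RCLike.reCLM) (main RCLike.imCLM)

theorem const_of_weak_deriv_zero (hI : IsOpen I) (hc : I.OrdConnected) (hne : I.Nonempty)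
    {u : ℝ → 𝕜} (hu : LocallyIntegrable u volume)
    (h : ∀ φ : ℝ → ℝ, ContDiff ℝ ∞ φ → HasCompactSupport φ → tsupport φ ⊆ I →
      ∫ x, deriv φ x • u x = 0) : ∃ C : 𝕜, ∀ᵐ x, x ∈ I → u x = C := by
  obtain ⟨x₀, hx₀⟩ := hne
  obtain ⟨ε, hε, hball⟩ := Metric.isOpen_iff.1 hI x₀ hx₀
  let B : ContDiffBump x₀ := ⟨ε / 4, ε / 2, by positivity, by linarith⟩
  let ψ : ℝ → ℝ := B.normed volume
  have ψ1 : ContDiff ℝ ∞ ψ := B.contDiff_normed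
  have ψ2 : HasCompactSupport ψ := B.hasCompactSupport_normed
  have ψ3 : tsupport ψ ⊆ I := by
    have e : tsupport ψ = Metric.closedBall x₀ (ε / 2) := B.tsupport_normed_eq
    rw [e]
    exact (Metric.closedBall_subset_ball (by linarith)).trans hball
  have ψ4 : ∫ x, ψ x = 1 := B.integral_normed
  refine ⟨∫ x, ψ x • u x, ?_⟩
  set C := ∫ x, ψ x • u x with hC
  have key := hI.ae_eq_zero_of_integral_contDiff_smul_eq_zero (μ := volume)
    (f := fun x => u x - C)
    ((hu.sub (locallyIntegrable_const C)).locallyIntegrableOn I) (fun φ h1 h2 h3 => by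
      let c : ℝ := ∫ x, φ x
      let θ : ℝ → ℝ := fun x => φ x - c * ψ x
      have θ1 : ContDiff ℝ ∞ θ := h1.sub (contDiff_const.mul ψ1)
      have θcont := θ1.continuous
      have θ2 : HasCompactSupport θ := h2.sub ψ2.mul_left
      have iφ : Integrable φ volume := h1.continuous.integrable_of_hasCompactSupport h2
      have iψ : Integrable ψ volume := ψ1.continuous.integrable_of_hasCompactSupport ψ2
      have θ0 : ∫ x, θ x = 0 := by
        change ∫ x, (φ x - c * ψ x) = 0
        rw [integral_sub iφ (iψ.const_mul c), integral_const_mul, ψ4]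
        simp [c]
      obtain ⟨A, D, hAI, hDI, hAD⟩ : ∃ A D, A ∈ I ∧ D ∈ I ∧
          Function.support θ ⊆ Ioc A D := by
        have hK : IsCompact (tsupport φ ∪ tsupport ψ) := h2.isCompact.union ψ2.isCompact
        have hKI : tsupport φ ∪ tsupport ψ ⊆ I := union_subset h3 ψ3
        have hKn : (tsupport φ ∪ tsupport ψ).Nonempty := by
          refine Nonempty.inr ?_
          have e : tsupport ψ = Metric.closedBall x₀ (ε / 2) := B.tsupport_normed_eq
          rw [e]
          exact ⟨x₀, Metric.mem_closedBall_self (by positivity)⟩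
        have hA := hK.sInf_mem hKn
        have hD := hK.sSup_mem hKn
        obtain ⟨δ, hδ, hb⟩ := Metric.isOpen_iff.1 hI _ (hKI hA)
        refine ⟨sInf (tsupport φ ∪ tsupport ψ) - δ / 2, _, hb ?_, hKI hD, ?_⟩
        · rw [Real.ball_eq_Ioo]; constructor <;> linarith
        · intro x hx
          have hxK : x ∈ tsupport φ ∪ tsupport ψ := by
            by_contra hn
            rw [mem_union, not_or] at hn
            exact hx (by simp [θ, image_eq_zero_of_notMem_tsupport hn.1,
              image_eq_zero_of_notMem_tsupport hn.2])
          have a1 := csInf_le hK.bddBelow hxK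
          exact ⟨by linarith, le_csSup hK.bddAbove hxK⟩
      let Θ : ℝ → ℝ := fun x => ∫ t in A..x, θ t
      have Θd : ∀ x, HasDerivAt Θ (θ x) x := fun x =>
        intervalIntegral.integral_hasDerivAt_right (θcont.intervalIntegrable _ _)
          (θcont.stronglyMeasurableAtFilter _ _) θcont.continuousAt
      have Θde : deriv Θ = θ := funext fun x => (Θd x).deriv
      have Θ1 : ContDiff ℝ ∞ Θ := by
        rw [contDiff_infty_iff_deriv]
        exact ⟨fun x => (Θd x).differentiableAt, Θde ▸ θ1⟩
      have Θs : Function.support Θ ⊆ Icc A D := by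
        intro x hx
        by_contra hn
        apply hx
        rw [mem_Icc, not_and_or, not_le, not_le] at hn
        rcases hn with hn | hn
        · change ∫ t in A..x, θ t = 0
          rw [intervalIntegral.integral_symm, intervalIntegral.integral_of_le hn.le,
            setIntegral_eq_zero_of_forall_eq_zero, neg_zero]
          intro t ht
          by_contra h0
          exact absurd (hAD h0).1 (not_lt.2 ht.2)
        · change ∫ t in A..x, θ t = 0
          rw [intervalIntegral.integral_eq_integral_of_support_subset, θ0]
          exact hAD.trans (Ioc_subset_Ioc_right hn.le)
      have Θt : tsupport Θ ⊆ Icc A D := closure_minimal Θs isClosed_Icc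
      have Θ2 : HasCompactSupport Θ := isCompact_Icc.of_isClosed_subset (isClosed_tsupport _) Θt
      have hz := h Θ Θ1 Θ2 (Θt.trans (hc.out hAI hDI))
      rw [Θde] at hz
      have i1 : Integrable (fun x => φ x • u x) volume :=
        hu.integrable_smul_left_of_hasCompactSupport h1.continuous h2
      have i2 : Integrable (fun x => ψ x • u x) volume :=
        hu.integrable_smul_left_of_hasCompactSupport ψ1.continuous ψ2
      have e1 : ∫ x, θ x • u x = ∫ x, (φ x • u x - c • (ψ x • u x)) := by
        congr 1; ext x; simp only [θ, sub_smul, mul_smul]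
      have i2c : Integrable (fun x => c • (ψ x • u x)) volume := i2.smul c
      rw [e1, integral_sub i1 i2c, integral_smul, ← hC] at hz
      simp_rw [smul_sub]
      rw [integral_sub i1 (iφ.smul_const C), integral_smul_const]
      exact hz)
  filter_upwards [key] with x hx hxI
  exact sub_eq_zero.1 (hx hxI)

theorem IsWeakDeriv.exists_continuous (hI : IsOpen I) (hc : I.OrdConnected)
    {f g : Lp 𝕜 2 (volume.restrict I)} (h : IsWeakDeriv I f g) :
    ∃ F : ℝ → 𝕜, Continuous F ∧ F =ᵐ[volume.restrict I] f ∧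
      ∀ x y, F y - F x = ∫ t in x..y, I.indicator g t := by
  have hg := locInt g hI.measurableSet
  have hf := locInt f hI.measurableSet
  have hgi : ∀ a b : ℝ, IntervalIntegrable (I.indicator g) volume a b := fun a b =>
    (hg.integrableOn_isCompact isCompact_uIcc).intervalIntegrable
  let G : ℝ → 𝕜 := fun x => ∫ t in (0 : ℝ)..x, I.indicator g t
  have hG : Continuous G := intervalIntegral.continuous_primitive hgi 0
  rcases I.eq_empty_or_nonempty with he | hne
  · refine ⟨G, hG, ?_, fun x y => intervalIntegral.integral_interval_sub_left (hgi _ _) (hgi _ _)⟩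
    rw [Filter.EventuallyEq, ae_restrict_iff' hI.measurableSet]
    exact Filter.Eventually.of_forall fun x hx => absurd hx (by simp [he])
  obtain ⟨C, hC⟩ := const_of_weak_deriv_zero hI hc hne (hf.sub hG.locallyIntegrable)
    (fun φ h1 h2 h3 => by
      have hd : Continuous (deriv φ) := h1.continuous_deriv (by simp)
      have b := by_parts hg h1 h2
      have w := h φ h1 h2 h3
      have e : ∀ (χ : ℝ → ℝ) (k : Lp 𝕜 2 (volume.restrict I)),
          ∫ x, χ x • I.indicator k x = ∫ x in I, χ x • k x := by
        intro χ k
        rw [← integral_indicator hI.measurableSet]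
        congr 1; ext x; by_cases hx : x ∈ I <;> simp [hx]
      rw [e] at b
      rw [← e] at w
      simp only [Pi.sub_apply, smul_sub]
      rw [integral_sub (hf.integrable_smul_left_of_hasCompactSupport hd h2.deriv)
        (hG.locallyIntegrable.integrable_smul_left_of_hasCompactSupport hd h2.deriv), w, b,
        sub_self])
  refine ⟨fun x => G x + C, hG.add continuous_const, ?_, fun x y => ?_⟩
  · rw [Filter.EventuallyEq, ae_restrict_iff' hI.measurableSet]
    filter_upwards [hC] with x hx hxI
    have := hx hxI
    simp only [Pi.sub_apply, indicator_of_mem hxI] at this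
    rw [← this]; ring
  · rw [add_sub_add_right_eq_sub]
    exact intervalIntegral.integral_interval_sub_left (hgi _ _) (hgi _ _)

theorem norm_sq_eq (f : Lp 𝕜 2 (volume.restrict I)) :
    ‖f‖ ^ 2 = ∫ x in I, ‖f x‖ ^ 2 := by
  have h := L2.inner_def (𝕜 := 𝕜) f f
  rw [inner_self_eq_norm_sq_to_K] at h
  have e : ∀ x, inner 𝕜 (f x) (f x) = ((‖f x‖ ^ 2 : ℝ) : 𝕜) := fun x => by
    rw [inner_self_eq_norm_sq_to_K]; push_cast; rfl
  simp_rw [e] at h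
  rw [integral_ofReal] at h
  exact_mod_cast h

theorem norm_boundaryValue_sq_le (hI : IsOpen I) (hc : I.OrdConnected)
    {f g : Lp 𝕜 2 (volume.restrict I)} (h : IsWeakDeriv I f g) {p q : ℝ} (hpq : p < q)
    (hsub : Ioo p q ⊆ I) {z : ℝ} (hz : z ∈ Icc p q) :
    ‖boundaryValue I f z‖ ^ 2 ≤ 2 / (q - p) * ‖f‖ ^ 2 + 2 * (q - p) * ‖g‖ ^ 2 := by
  obtain ⟨F, hF, hFf, hFg⟩ := h.exists_continuous hI hc
  have hzI : z ∈ closure I := closure_mono hsub (by rwa [closure_Ioo hpq.ne])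
  rw [boundaryValue_eq hI hF.continuousOn hFf hzI]
  have hl : 0 < q - p := sub_pos.2 hpq
  have if2 : IntegrableOn (fun x => ‖f x‖ ^ 2) I volume := (Lp.memLp f).integrable_norm_pow (by simp)
  have ig2 : IntegrableOn (fun x => ‖g x‖ ^ 2) I volume := (Lp.memLp g).integrable_norm_pow (by simp)
  have hg := locInt g hI.measurableSet
  set N : ℝ := ∫ t in Ioo p q, ‖g t‖ with hN
  have igJ : MemLp g 2 (volume.restrict (Ioo p q)) :=
    (Lp.memLp g).mono_measure (Measure.restrict_mono hsub le_rfl)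
  have igN : Integrable (fun t => ‖g t‖) (volume.restrict (Ioo p q)) :=
    (igJ.integrable (by norm_num)).norm
  have hN2 : N ^ 2 ≤ (q - p) * ‖g‖ ^ 2 := by
    have hv : volume.real (Ioo p q) = q - p := by simp [Measure.real, hl.le]
    have igJ2 : Integrable (fun t => ‖g t‖ ^ 2) (volume.restrict (Ioo p q)) :=
      igJ.integrable_norm_pow (by simp)
    have hnn : 0 ≤ ∫ t in Ioo p q, (‖g t‖ - N / (q - p)) ^ 2 :=
      integral_nonneg fun t => sq_nonneg _
    have e : ∀ t, (‖g t‖ - N / (q - p)) ^ 2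
        = ‖g t‖ ^ 2 - (2 * (N / (q - p)) * ‖g t‖ - (N / (q - p)) ^ 2) := fun t => by ring
    simp_rw [e] at hnn
    have ic : Integrable (fun _ : ℝ => (N / (q - p)) ^ 2) (volume.restrict (Ioo p q)) :=
      integrable_const _
    have ims : Integrable (fun t => 2 * (N / (q - p)) * ‖g t‖ - (N / (q - p)) ^ 2)
        (volume.restrict (Ioo p q)) := (igN.const_mul _).sub ic
    rw [integral_sub igJ2 ims, integral_sub (igN.const_mul _) ic,
      integral_const_mul, integral_const, ← hN] at hnn
    simp only [MeasurableSet.univ, measureReal_restrict_apply, univ_inter, hv, smul_eq_mul] at hnn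
    have mono : ∫ t in Ioo p q, ‖g t‖ ^ 2 ≤ ‖g‖ ^ 2 := by
      rw [norm_sq_eq]
      exact setIntegral_mono_set ig2 (Filter.Eventually.of_forall fun t => by positivity)
        (LE.le.eventuallyLE hsub)
    have : (q - p) * (2 * (N / (q - p)) * N - (q - p) * (N / (q - p)) ^ 2) = N ^ 2 := by
      field_simp; ring
    nlinarith
  have pt : ∀ᵐ y ∂(volume.restrict (Ioo p q)), ‖F z‖ ^ 2 ≤ 2 * ‖f y‖ ^ 2 + 2 * N ^ 2 := by
    have hFJ : F =ᵐ[volume.restrict (Ioo p q)] f :=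
      hFf.filter_mono (ae_mono (Measure.restrict_mono hsub le_rfl))
    filter_upwards [hFJ, ae_restrict_mem measurableSet_Ioo] with y hy hyJ
    have hb : ‖F z - F y‖ ≤ N := by
      rw [hFg y z]
      have hsubI : uIoc y z ⊆ Ioc p q := by
        intro t ht
        rw [uIoc, mem_Ioc] at ht
        refine ⟨lt_of_le_of_lt (le_min hyJ.1.le hz.1) ht.1, ht.2.trans (max_le hyJ.2.le hz.2)⟩
      refine intervalIntegral.norm_integral_le_integral_norm_uIoc.trans ?_
      have e1 : N = ∫ t in Ioc p q, ‖I.indicator g t‖ := by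
        rw [integral_Ioc_eq_integral_Ioo]
        refine setIntegral_congr_fun measurableSet_Ioo fun t ht => ?_
        simp [hsub ht]
      rw [e1]
      refine setIntegral_mono_set ?_ (Filter.Eventually.of_forall fun t => norm_nonneg _)
        (LE.le.eventuallyLE hsubI)
      exact ((hg.integrableOn_isCompact isCompact_Icc).mono_set Ioc_subset_Icc_self).norm
    rw [← hy]
    have h1 : ‖F z‖ ≤ ‖F y‖ + N := by
      have := norm_add_le (F y) (F z - F y)
      rw [add_sub_cancel] at this
      linarith
    have h2 : ‖F z‖ ^ 2 ≤ (‖F y‖ + N) ^ 2 := by gcongr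
    nlinarith [sq_nonneg (‖F y‖ - N)]
  have hint : (q - p) * ‖F z‖ ^ 2 ≤ 2 * ‖f‖ ^ 2 + (q - p) * (2 * N ^ 2) := by
    have hv : volume.real (Ioo p q) = q - p := by simp [Measure.real, hl.le]
    have if2J := if2.mono_set hsub
    have ic : ∀ c : ℝ, Integrable (fun _ : ℝ => c) (volume.restrict (Ioo p q)) :=
      fun c => integrable_const c
    have := integral_mono_ae (ic (‖F z‖ ^ 2)) ((if2J.const_mul 2).add (ic (2 * N ^ 2))) pt
    simp only [Pi.add_apply] at this
    rw [integral_add (if2J.const_mul 2) (ic _), integral_const, integral_const,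
      integral_const_mul] at this
    simp only [MeasurableSet.univ, measureReal_restrict_apply, univ_inter, hv, smul_eq_mul] at this
    have mono : ∫ t in Ioo p q, ‖f t‖ ^ 2 ≤ ‖f‖ ^ 2 := by
      rw [norm_sq_eq]
      exact setIntegral_mono_set if2 (Filter.Eventually.of_forall fun t => by positivity)
        (LE.le.eventuallyLE hsub)
    linarith
  have e2 : 2 / (q - p) * ‖f‖ ^ 2 + 2 * (q - p) * ‖g‖ ^ 2
      = (2 * ‖f‖ ^ 2 + (q - p) * (2 * ((q - p) * ‖g‖ ^ 2))) / (q - p) := by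
    field_simp
  rw [e2, le_div_iff₀ hl]
  nlinarith [mul_le_mul_of_nonneg_left hN2 hl.le]

theorem boundaryValue_add (hI : IsOpen I) (hc : I.OrdConnected)
    {f g f' g' : Lp 𝕜 2 (volume.restrict I)} (hf : IsWeakDeriv I f f') (hg : IsWeakDeriv I g g')
    {z : ℝ} (hz : z ∈ closure I) :
    boundaryValue I (f + g) z = boundaryValue I f z + boundaryValue I g z := by
  obtain ⟨F, hF, hFf, -⟩ := hf.exists_continuous hI hc
  obtain ⟨G, hG, hGg, -⟩ := hg.exists_continuous hI hc
  rw [boundaryValue_eq hI hF.continuousOn hFf hz, boundaryValue_eq hI hG.continuousOn hGg hz]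
  refine boundaryValue_eq (F := fun x => F x + G x) hI (hF.add hG).continuousOn ?_ hz
  filter_upwards [hFf, hGg, Lp.coeFn_add f g] with x h1 h2 h3
  rw [h3, h1, h2, Pi.add_apply]

theorem boundaryValue_smul (hI : IsOpen I) (hc : I.OrdConnected) (c : 𝕜)
    {f f' : Lp 𝕜 2 (volume.restrict I)} (hf : IsWeakDeriv I f f') {z : ℝ} (hz : z ∈ closure I) :
    boundaryValue I (c • f) z = c * boundaryValue I f z := by
  obtain ⟨F, hF, hFf, -⟩ := hf.exists_continuous hI hc
  rw [boundaryValue_eq hI hF.continuousOn hFf hz]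
  refine boundaryValue_eq (F := fun x => c * F x) hI (hF.const_smul c).continuousOn ?_ hz
  filter_upwards [hFf, Lp.coeFn_smul c f] with x h1 h3
  rw [h3, h1, Pi.smul_apply, smul_eq_mul]

end Edge

/-- A metric graph with vertex set `V` and edge set `E` (both of arbitrary cardinality), as a
directed multigraph. The edge `e` is the interval `(a e, b e) ⊆ ℝ`, possibly unbounded.
Edges with `a e > -∞` have a starting vertex, edges with `b e < ∞` have an end vertex. -/
structure MetricGraph (V E : Type*) where
  a : E → EReal
  b : E → EReal
  a_lt_b : ∀ e, a e < b e
  γ₀ : {e : E // ⊥ < a e} → V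
  γ₁ : {e : E // b e < ⊤} → V

namespace MetricGraph

variable {V E : Type*} (Γ : MetricGraph V E) (𝕜 : Type*) [RCLike 𝕜]

/-- The open interval `(aₑ, bₑ) ⊆ ℝ`. -/
def edge (e : E) : Set ℝ := {x | Γ.a e < (x : EReal) ∧ (x : EReal) < Γ.b e}

theorem isOpen_edge (e : E) : IsOpen (Γ.edge e) :=
  (isOpen_lt continuous_const continuous_coe_real_ereal).inter
    (isOpen_lt continuous_coe_real_ereal continuous_const)

theorem ordConnected_edge (e : E) : (Γ.edge e).OrdConnected :=
  ⟨fun _ hx _ hy _ hz => ⟨hx.1.trans_le (EReal.coe_le_coe_iff.2 hz.1),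
    (EReal.coe_le_coe_iff.2 hz.2).trans_lt hy.2⟩⟩

/-- The Hilbert space direct sum `⨁ₑ L₂(aₑ, bₑ)`. -/
noncomputable abbrev Space := lp (fun e : E => Lp 𝕜 2 (volume.restrict (Γ.edge e))) 2

/-- The set `E'` of all finite boundary points of all edges: `Sum.inl e` is the left endpoint
`aₑ > -∞` of `e`, and `Sum.inr e` is the right endpoint `bₑ < ∞` of `e`. -/
abbrev Endpoint := {e : E // ⊥ < Γ.a e} ⊕ {e : E // Γ.b e < ⊤}

/-- The Hilbert space `ℓ₂(E')`. -/
noncomputable abbrev BoundarySpace := lp (fun _ : Γ.Endpoint => 𝕜) 2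

variable {𝕜}

/-- `f` is edgewise weakly differentiable with derivative `g`. -/
def HasWeakDeriv (f g : Γ.Space 𝕜) : Prop := ∀ e, IsWeakDeriv (Γ.edge e) (f e) (g e)

variable {Γ} in
theorem HasWeakDeriv.add {f g f' g' : Γ.Space 𝕜} (h : Γ.HasWeakDeriv f g)
    (h' : Γ.HasWeakDeriv f' g') : Γ.HasWeakDeriv (f + f') (g + g') :=
  fun e => (h e).add (h' e)

variable {Γ} in
theorem HasWeakDeriv.smul {f g : Γ.Space 𝕜} (c : 𝕜) (h : Γ.HasWeakDeriv f g) :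
    Γ.HasWeakDeriv (c • f) (c • g) :=
  fun e => (h e).smul c

variable {Γ} in
theorem HasWeakDeriv.unique {f g g' : Γ.Space 𝕜} (h : Γ.HasWeakDeriv f g)
    (h' : Γ.HasWeakDeriv f g') : g = g' :=
  lp.ext (funext fun e => (h e).unique (Γ.isOpen_edge e) (h' e))

variable (𝕜)

/-- `⨁ₑ W_2^1(aₑ, bₑ)`: the `f ∈ ⨁ₑ L₂(aₑ, bₑ)` that have an edgewise weak derivative in
`⨁ₑ L₂(aₑ, bₑ)`. -/
noncomputable def W1 : Submodule 𝕜 (Γ.Space 𝕜) where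
  carrier := {f | ∃ g, Γ.HasWeakDeriv f g}
  add_mem' := fun ⟨g, hg⟩ ⟨g', hg'⟩ => ⟨g + g', hg.add hg'⟩
  zero_mem' := ⟨0, fun e φ _ _ _ => by
    rw [show (0 : Γ.Space 𝕜) e = (0 : ℝ) • (0 : Lp 𝕜 2 (volume.restrict (Γ.edge e))) by simp]
    have h1 : ∀ χ : ℝ → ℝ, ∫ x in Γ.edge e, χ x •
        ((0 : ℝ) • (0 : Lp 𝕜 2 (volume.restrict (Γ.edge e)))) x = 0 := fun χ => by
      rw [zero_smul]
      refine integral_eq_zero_of_ae ?_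
      filter_upwards [Lp.coeFn_zero 𝕜 2 (volume.restrict (Γ.edge e))] with x hx
      rw [hx]; simp
    rw [h1, h1, neg_zero]⟩
  smul_mem' := fun c _ ⟨g, hg⟩ => ⟨c • g, hg.smul c⟩

variable {𝕜}

/-- `f ↦ f' = (fₑ')ₑ` on `⨁ₑ W_2^1(aₑ, bₑ)`. -/
noncomputable def weakDeriv : Γ.W1 𝕜 →ₗ[𝕜] Γ.Space 𝕜 where
  toFun f := f.2.choose
  map_add' f g := (f + g).2.choose_spec.unique (f.2.choose_spec.add g.2.choose_spec)
  map_smul' c f := (c • f).2.choose_spec.unique (f.2.choose_spec.smul c)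

theorem hasWeakDeriv_weakDeriv (f : Γ.W1 𝕜) : Γ.HasWeakDeriv f (Γ.weakDeriv f) :=
  f.2.choose_spec

variable (𝕜)

/-- `⨁ₑ W_2^2(aₑ, bₑ)`: the `f ∈ ⨁ₑ W_2^1(aₑ, bₑ)` with `f' ∈ ⨁ₑ W_2^1(aₑ, bₑ)`. -/
noncomputable def W2 : Submodule 𝕜 (Γ.Space 𝕜) :=
  ((Γ.W1 𝕜).comap Γ.weakDeriv).map (Γ.W1 𝕜).subtype

variable {𝕜}

/-- The inclusion of `⨁ₑ W_2^2(aₑ, bₑ)` in `⨁ₑ W_2^1(aₑ, bₑ)`. -/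
noncomputable def toW1 : Γ.W2 𝕜 →ₗ[𝕜] Γ.W1 𝕜 :=
  Submodule.inclusion (Submodule.map_subtype_le _ _)

theorem weakDeriv_toW1_mem (f : Γ.W2 𝕜) : Γ.weakDeriv (Γ.toW1 f) ∈ Γ.W1 𝕜 := by
  obtain ⟨_, g, hg, rfl⟩ := f
  exact hg

/-- `f ↦ f'` as a map from `⨁ₑ W_2^2(aₑ, bₑ)` to `⨁ₑ W_2^1(aₑ, bₑ)`. -/
noncomputable def firstDeriv : Γ.W2 𝕜 →ₗ[𝕜] Γ.W1 𝕜 :=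
  (Γ.weakDeriv ∘ₗ Γ.toW1).codRestrict (Γ.W1 𝕜) (Γ.weakDeriv_toW1_mem)

variable (𝕜)

/-- The maximal Laplacian: domain `⨁ₑ W_2^2(aₑ, bₑ)`, `f ↦ (-fₑ'')ₑ`. -/
noncomputable def maximalLaplacian : Γ.Space 𝕜 →ₗ.[𝕜] Γ.Space 𝕜 where
  domain := Γ.W2 𝕜
  toFun := -(Γ.weakDeriv ∘ₗ Γ.firstDeriv)

variable {𝕜}

theorem exists_Ioo_subset {r : ℝ} (hr : 0 < r) (hl : ∀ e, (r : EReal) ≤ Γ.b e - Γ.a e)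
    (p : Γ.Endpoint) : ∃ c : ℝ, Ioo c (c + r) ⊆ Γ.edge (p.elim Subtype.val Subtype.val) ∧
      p.elim (fun e => (Γ.a e.1).toReal) (fun e => (Γ.b e.1).toReal) ∈ Icc c (c + r) := by
  rcases p with ⟨e, he⟩ | ⟨e, he⟩
  · have hab := Γ.a_lt_b e
    have hle := hl e
    obtain ⟨α, hα⟩ : ∃ α : ℝ, Γ.a e = α :=
      ⟨(Γ.a e).toReal, (EReal.coe_toReal (ne_top_of_lt hab) he.ne').symm⟩
    refine ⟨α, fun x hx => ⟨?_, ?_⟩, ?_⟩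
    · change Γ.a e < _
      rw [hα]; exact_mod_cast hx.1
    · change _ < Γ.b e
      rw [hα] at hle
      have h1 : ((α + r : ℝ) : EReal) ≤ Γ.b e := by
        have := (EReal.le_sub_iff_add_le (.inl (EReal.coe_ne_bot α))
          (.inl (EReal.coe_ne_top α))).1 hle
        rw [add_comm] at this
        exact_mod_cast this
      exact lt_of_lt_of_le (by exact_mod_cast hx.2) h1
    · simp only [Sum.elim_inl, hα, EReal.toReal_coe, mem_Icc]; constructor <;> linarith
  · have hab := Γ.a_lt_b e
    have hle := hl e
    obtain ⟨β, hβ⟩ : ∃ β : ℝ, Γ.b e = β :=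
      ⟨(Γ.b e).toReal, (EReal.coe_toReal he.ne (ne_bot_of_gt hab)).symm⟩
    refine ⟨β - r, fun x hx => ⟨?_, ?_⟩, ?_⟩
    · change Γ.a e < _
      rw [hβ] at hle hab
      have h1 : Γ.a e ≤ ((β - r : ℝ) : EReal) := by
        induction h : Γ.a e with
        | bot => exact bot_le
        | top => rw [h] at hab; exact absurd hab (not_lt.2 le_top)
        | coe α =>
          rw [h] at hle
          have : r ≤ β - α := by exact_mod_cast hle
          exact_mod_cast (by linarith : α ≤ β - r)
      exact lt_of_le_of_lt h1 (by exact_mod_cast hx.1)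
    · change _ < Γ.b e
      have := hx.2
      rw [hβ]; exact_mod_cast (by linarith : x < β)
    · simp only [Sum.elim_inr, hβ, EReal.toReal_coe, mem_Icc]; constructor <;> linarith

/-- The boundary values of `f`: `(e, 0) ↦ fₑ(aₑ)`, `(e, 1) ↦ fₑ(bₑ)`. -/
noncomputable def boundaryValues (f : Γ.Space 𝕜) : Γ.Endpoint → 𝕜
  | .inl e => boundaryValue (Γ.edge e) (f e) (Γ.a e).toReal
  | .inr e => boundaryValue (Γ.edge e) (f e) (Γ.b e).toReal

/-- The signed boundary values of `f`: `(e, 0) ↦ fₑ(aₑ)`, `(e, 1) ↦ -fₑ(bₑ)`. -/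
noncomputable def signedBoundaryValues (f : Γ.Space 𝕜) : Γ.Endpoint → 𝕜
  | .inl e => boundaryValue (Γ.edge e) (f e) (Γ.a e).toReal
  | .inr e => -boundaryValue (Γ.edge e) (f e) (Γ.b e).toReal

theorem norm_signedBoundaryValues (f : Γ.Space 𝕜) (p : Γ.Endpoint) :
    ‖Γ.signedBoundaryValues f p‖ = ‖Γ.boundaryValues f p‖ := by
  cases p <;> simp [signedBoundaryValues, boundaryValues]

theorem norm_boundaryValues_sq_le {r : ℝ} (hr : 0 < r) (hl : ∀ e, (r : EReal) ≤ Γ.b e - Γ.a e)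
    {f g : Γ.Space 𝕜} (hg : Γ.HasWeakDeriv f g) (p : Γ.Endpoint) :
    ‖Γ.boundaryValues f p‖ ^ 2
      ≤ 2 / r * ‖f (p.elim Subtype.val Subtype.val)‖ ^ 2 + 2 * r * ‖g (p.elim Subtype.val Subtype.val)‖ ^ 2 := by
  obtain ⟨c, hc, hp⟩ := Γ.exists_Ioo_subset hr hl p
  have := norm_boundaryValue_sq_le (Γ.isOpen_edge _) (Γ.ordConnected_edge _)
    (hg (p.elim Subtype.val Subtype.val)) (by linarith : c < c + r) hc hp
  rw [add_sub_cancel_left] at this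
  cases p <;> exact this

theorem exists_length {Γ : MetricGraph V E} (hΓ : 0 < ⨅ e, (Γ.b e - Γ.a e)) :
    ∃ r : ℝ, 0 < r ∧ ∀ e, (r : EReal) ≤ Γ.b e - Γ.a e := by
  obtain ⟨r, hr, hlt⟩ := EReal.lt_iff_exists_real_btwn.1 hΓ
  exact ⟨r, by exact_mod_cast hr, fun e => hlt.le.trans (iInf_le _ e)⟩

theorem memℓp_boundaryValues (hΓ : 0 < ⨅ e, (Γ.b e - Γ.a e)) (f : Γ.W1 𝕜) :
    Memℓp (Γ.boundaryValues (f : Γ.Space 𝕜)) 2 := by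
  obtain ⟨r, hr, hl⟩ := exists_length hΓ
  obtain ⟨f, g, hg⟩ := f
  have hs : ∀ u : Γ.Space 𝕜, Summable fun e => ‖u e‖ ^ 2 := fun u => by
    have := (lp.memℓp u).summable (by simp)
    simpa using this
  have hS : Summable fun e => 2 / r * ‖f e‖ ^ 2 + 2 * r * ‖g e‖ ^ 2 :=
    ((hs f).mul_left _).add ((hs g).mul_left _)
  refine memℓp_gen ?_
  simp only [ENNReal.toReal_ofNat, Real.rpow_ofNat]
  refine Summable.of_nonneg_of_le (fun p => by positivity)
    (fun p => Γ.norm_boundaryValues_sq_le hr hl hg p) ?_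
  exact Summable.sum _ (hS.subtype _) (hS.subtype _)

theorem memℓp_signedBoundaryValues (hΓ : 0 < ⨅ e, (Γ.b e - Γ.a e)) (f : Γ.W1 𝕜) :
    Memℓp (Γ.signedBoundaryValues (f : Γ.Space 𝕜)) 2 := by
  have h := (Γ.memℓp_boundaryValues hΓ f).summable (by simp)
  refine memℓp_gen ?_
  simp_rw [norm_signedBoundaryValues]
  exact h

theorem boundaryValues_add (hΓ : 0 < ⨅ e, (Γ.b e - Γ.a e)) (f g : Γ.W1 𝕜) (p : Γ.Endpoint) :
    Γ.boundaryValues (f + g : Γ.Space 𝕜) p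
      = Γ.boundaryValues (f : Γ.Space 𝕜) p + Γ.boundaryValues (g : Γ.Space 𝕜) p := by
  obtain ⟨r, hr, hl⟩ := exists_length hΓ
  obtain ⟨c, hc, hp⟩ := Γ.exists_Ioo_subset hr hl p
  obtain ⟨f, f', hf⟩ := f
  obtain ⟨g, g', hg⟩ := g
  have := boundaryValue_add (Γ.isOpen_edge _) (Γ.ordConnected_edge _)
    (hf (p.elim Subtype.val Subtype.val)) (hg (p.elim Subtype.val Subtype.val))
    (closure_mono hc (by rwa [closure_Ioo (by linarith)]))
  cases p <;> exact this

theorem boundaryValues_smul (hΓ : 0 < ⨅ e, (Γ.b e - Γ.a e)) (c : 𝕜) (f : Γ.W1 𝕜)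
    (p : Γ.Endpoint) :
    Γ.boundaryValues (c • f : Γ.Space 𝕜) p = c * Γ.boundaryValues (f : Γ.Space 𝕜) p := by
  obtain ⟨r, hr, hl⟩ := exists_length hΓ
  obtain ⟨d, hd, hp⟩ := Γ.exists_Ioo_subset hr hl p
  obtain ⟨f, f', hf⟩ := f
  have := boundaryValue_smul (Γ.isOpen_edge _) (Γ.ordConnected_edge _) c
    (hf (p.elim Subtype.val Subtype.val)) (closure_mono hd (by rwa [closure_Ioo (by linarith)]))
  cases p <;> exact this

/-- The trace `⨁ₑ W_2^1(aₑ, bₑ) → ℓ₂(E')`, defined if the edge lengths have a positive lower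
bound. -/
noncomputable def trace (hΓ : 0 < ⨅ e, (Γ.b e - Γ.a e)) :
    Γ.W1 𝕜 →ₗ[𝕜] Γ.BoundarySpace 𝕜 where
  toFun f := ⟨Γ.boundaryValues (f : Γ.Space 𝕜), Γ.memℓp_boundaryValues hΓ f⟩
  map_add' f g := lp.ext (funext fun p => Γ.boundaryValues_add hΓ f g p)
  map_smul' c f := lp.ext (funext fun p => Γ.boundaryValues_smul hΓ c f p)

/-- The signed trace `⨁ₑ W_2^1(aₑ, bₑ) → ℓ₂(E')`, defined if the edge lengths have a positive
lower bound. -/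
noncomputable def signedTrace (hΓ : 0 < ⨅ e, (Γ.b e - Γ.a e)) :
    Γ.W1 𝕜 →ₗ[𝕜] Γ.BoundarySpace 𝕜 where
  toFun f := ⟨Γ.signedBoundaryValues (f : Γ.Space 𝕜), Γ.memℓp_signedBoundaryValues hΓ f⟩
  map_add' f g := lp.ext (funext fun p => by
    have h := Γ.boundaryValues_add hΓ f g p
    rcases p with e | e
    · exact h
    · exact (congrArg Neg.neg h).trans (neg_add _ _))
  map_smul' c f := lp.ext (funext fun p => by
    have h := Γ.boundaryValues_smul hΓ c f p
    rcases p with e | e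
    · exact h
    · exact (congrArg Neg.neg h).trans (neg_mul_eq_mul_neg _ _))

end MetricGraph

end QuantumGraph

/-!
The maps `tr` and `str ∘ (·)'` form a boundary triple for the maximal Laplacian `Ĥ`: they satisfy
Green's identity, they are jointly onto, and `Ĥ` is the adjoint of its restriction to their common
kernel. The last property comes from solving the Neumann problem `f - f'' = h`, `str f' = 0`, by
projecting `(h, 0)` onto the closed graph of the weak derivative.

For any boundary triple, Green's identity turns the adjoint of a restriction of `Ĥ` into the
adjoint of the linear relation which its boundary values form in `ℓ₂(E')`, so that self-adjoint
restrictions correspond to self-adjoint relations. Such a relation splits off its purely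
multivalued part: it is the sum of the graph of a self-adjoint operator `L` in the closure `X` of
its domain and of `{0} × Xᗮ`.
-/

namespace QuantumGraph

open MeasureTheory Set Filter Topology
open scoped InnerProductSpace ContDiff

/-! ### Linear relations -/

section LinearRelation

variable {𝕜 E F : Type*} [RCLike 𝕜] [NormedAddCommGroup E] [InnerProductSpace 𝕜 E]
  [NormedAddCommGroup F] [InnerProductSpace 𝕜 F]

theorem mem_adjoint_iff_inner_eq {G : Submodule 𝕜 (E × F)} {y : F} {w : E} :
    (y, w) ∈ G.adjoint ↔ ∀ p ∈ G, ⟪w, p.1⟫_𝕜 = ⟪y, p.2⟫_𝕜 := by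
  simp_rw [Submodule.mem_adjoint_iff, Prod.forall, sub_eq_zero]
  refine forall₃_congr fun a b _ => ?_
  rw [← inner_conj_symm y b, ← inner_conj_symm w a, (starRingEnd 𝕜).injective.eq_iff, eq_comm]

theorem adjoint_antitone : Antitone (Submodule.adjoint : Submodule 𝕜 (E × F) → _) :=
  fun _ _ h _ hp => mem_adjoint_iff_inner_eq.2 fun q hq => mem_adjoint_iff_inner_eq.1 hp q (h hq)

theorem zero_mk_mem_adjoint_iff {G : Submodule 𝕜 (E × F)} {w : E} :
    ((0 : F), w) ∈ G.adjoint ↔ w ∈ (G.map (LinearMap.fst 𝕜 E F))ᗮ := by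
  simp [Submodule.mem_orthogonal]

theorem isSelfAdjoint_iff_adjoint_graph_eq [CompleteSpace E] {H : E →ₗ.[𝕜] E} :
    IsSelfAdjoint H ↔ H.graph.adjoint = H.graph := by
  refine ⟨fun h => ?_, fun h => ?_⟩
  · rw [← LinearPMap.adjoint_graph_eq_graph_adjoint h.dense_domain,
      LinearPMap.isSelfAdjoint_def.1 h]
  · have hdense : Dense (H.domain : Set E) := by
      rw [Submodule.dense_iff_topologicalClosure_eq_top, Submodule.topologicalClosure_eq_top_iff,
        Submodule.eq_bot_iff, ← LinearPMap.graph_map_fst_eq_domain]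
      intro w hw
      rw [← zero_mk_mem_adjoint_iff, h] at hw
      exact H.graph_fst_eq_zero_snd hw rfl
    exact LinearPMap.eq_of_eq_graph
      ((LinearPMap.adjoint_graph_eq_graph_adjoint hdense).trans h)

variable (X : Submodule 𝕜 E) [X.HasOrthogonalProjection]

/-- The linear relation `{(x, u) | x ∈ X, (x, Q u) ∈ G}` in `E` induced by a linear relation `G`
in the subspace `X` with orthogonal projection `Q : E → X`: the orthogonal sum of `G` and the
purely multivalued relation `{0} × Xᗮ`. -/
noncomputable def liftRelation (G : Submodule 𝕜 (X × X)) : Submodule 𝕜 (E × E) :=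
  (G.comap (LinearMap.id.prodMap (X.orthogonalProjectionOnto : E →ₗ[𝕜] X))).map
    (X.subtype.prodMap LinearMap.id)

variable {X} {G : Submodule 𝕜 (X × X)}

theorem mem_liftRelation {x u : E} :
    (x, u) ∈ liftRelation X G ↔ ∃ hx : x ∈ X, (⟨x, hx⟩, X.orthogonalProjectionOnto u) ∈ G := by
  simp [liftRelation]

theorem coe_mk_mem_liftRelation {x u : X} : ((x : E), (u : E)) ∈ liftRelation X G ↔ (x, u) ∈ G := by
  simp [mem_liftRelation]

theorem liftRelation_injective : Function.Injective (liftRelation X) := fun G G' h => by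
  ext ⟨x, u⟩
  rw [← coe_mk_mem_liftRelation, h, coe_mk_mem_liftRelation]

theorem mem_liftRelation_graph {L : X →ₗ.[𝕜] X} {x u : E} :
    (x, u) ∈ liftRelation X L.graph ↔
      ∃ y : L.domain, ((y : X) : E) = x ∧ L y = X.orthogonalProjectionOnto u := by
  simp only [mem_liftRelation, LinearPMap.mem_graph_iff]
  constructor
  · rintro ⟨hx, y, hy, hL⟩
    exact ⟨y, congrArg Subtype.val hy, hL⟩
  · rintro ⟨y, rfl, hL⟩
    exact ⟨(y : X).2, y, rfl, hL⟩

theorem adjoint_liftRelation : (liftRelation X G).adjoint = liftRelation X G.adjoint := by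
  ext ⟨y, v⟩
  simp only [mem_liftRelation, mem_adjoint_iff_inner_eq]
  constructor
  · intro h
    have hy : y ∈ X := by
      rw [← X.orthogonal_orthogonal, Submodule.mem_orthogonal']
      intro u hu
      have hmem : ((0 : E), u) ∈ liftRelation X G := mem_liftRelation.2 ⟨X.zero_mem, by
        rw [Submodule.orthogonalProjectionOnto_eq_zero_iff.2 hu]; exact G.zero_mem⟩
      simpa using (h _ hmem).symm
    refine ⟨hy, fun p hp => ?_⟩
    simpa using h (p.1, p.2) (coe_mk_mem_liftRelation.2 hp)
  · rintro ⟨hy, h⟩ ⟨x, u⟩ hp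
    obtain ⟨hx, hG⟩ := mem_liftRelation.1 hp
    simpa using h _ hG

theorem eq_liftRelation_comap {Θ : Submodule 𝕜 (E × E)} (hfst : Θ.map (LinearMap.fst 𝕜 E E) ≤ X)
    (hmul : ∀ u ∈ Xᗮ, ((0 : E), u) ∈ Θ) :
    Θ = liftRelation X (Θ.comap (X.subtype.prodMap X.subtype)) := by
  ext ⟨x, u⟩
  have hproj : ((0 : E), u - X.orthogonalProjectionOnto u) ∈ Θ :=
    hmul _ (X.sub_starProjection_mem_orthogonal u)
  have hiff : (x, u) ∈ Θ ↔ (x, (X.orthogonalProjectionOnto u : E)) ∈ Θ := by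
    rw [← Θ.sub_mem_iff_left hproj]; simp
  rw [mem_liftRelation, hiff]
  exact ⟨fun h => ⟨hfst ⟨_, h, rfl⟩, h⟩, fun ⟨_, h⟩ => h⟩

theorem adjoint_eq_self_iff_exists_isSelfAdjoint [CompleteSpace E] {Θ : Submodule 𝕜 (E × E)} :
    Θ.adjoint = Θ ↔ ∃ (X : Submodule 𝕜 E) (hX : IsClosed (X : Set E)),
      haveI : CompleteSpace X := hX.completeSpace_coe
      ∃ L : X →ₗ.[𝕜] X, IsSelfAdjoint L ∧ Θ = liftRelation X L.graph := by
  constructor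
  · intro hΘ
    let X := (Θ.map (LinearMap.fst 𝕜 E E)).topologicalClosure
    have hX : IsClosed (X : Set E) := Submodule.isClosed_topologicalClosure _
    have : CompleteSpace X := hX.completeSpace_coe
    have hmul : ∀ u, ((0 : E), u) ∈ Θ ↔ u ∈ Xᗮ := fun u => by
      rw [Submodule.orthogonal_closure, ← zero_mk_mem_adjoint_iff, hΘ]
    let G := Θ.comap (X.subtype.prodMap X.subtype)
    have hlift : Θ = liftRelation X G :=
      eq_liftRelation_comap (Submodule.le_topologicalClosure _) fun u hu => (hmul u).2 hu
    have hgraph : G.toLinearPMap.graph = G := Submodule.toLinearPMap_graph_eq G fun p hp h0 => by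
      have hp' : ((p.1 : E), (p.2 : E)) ∈ Θ := hp
      rw [h0, Submodule.coe_zero, hmul] at hp'
      exact Subtype.ext (inner_self_eq_zero (𝕜 := 𝕜).1 (hp' _ p.2.2))
    refine ⟨X, hX, G.toLinearPMap, ?_, by rwa [hgraph]⟩
    rw [isSelfAdjoint_iff_adjoint_graph_eq, hgraph]
    rw [hlift, adjoint_liftRelation] at hΘ
    exact liftRelation_injective hΘ
  · rintro ⟨X, hX, L, hL, rfl⟩
    have : CompleteSpace X := hX.completeSpace_coe
    rw [adjoint_liftRelation, isSelfAdjoint_iff_adjoint_graph_eq.1 hL]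

end LinearRelation

/-! ### Boundary triples -/

section BoundaryTriple

variable {𝕜 ℋ B : Type*} [RCLike 𝕜] [NormedAddCommGroup ℋ] [InnerProductSpace 𝕜 ℋ]
  [NormedAddCommGroup B] [InnerProductSpace 𝕜 B]
  {A : ℋ →ₗ.[𝕜] ℋ} {Γ₀ Γ₁ : A.domain →ₗ[𝕜] B} {Θ Θ' : Submodule 𝕜 (B × B)}

/-- The graph of the restriction of `A` to those `f` whose boundary data `(Γ₀ f, Γ₁ f)` belong to
the linear relation `Θ`. -/
def boundaryConditionGraph (Γ₀ Γ₁ : A.domain →ₗ[𝕜] B) (Θ : Submodule 𝕜 (B × B)) :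
    Submodule 𝕜 (ℋ × ℋ) :=
  (Θ.comap (Γ₀.prod Γ₁)).map (A.domain.subtype.prod A.toFun)

theorem coe_apply_mem_boundaryConditionGraph {f : A.domain} :
    ((f : ℋ), A f) ∈ boundaryConditionGraph Γ₀ Γ₁ Θ ↔ (Γ₀ f, Γ₁ f) ∈ Θ := by
  refine ⟨?_, fun h => ⟨f, h, rfl⟩⟩
  rintro ⟨g, hg, hgf⟩
  rwa [← Subtype.ext (congrArg Prod.fst hgf)]

theorem boundaryConditionGraph_mono (h : Θ ≤ Θ') :
    boundaryConditionGraph Γ₀ Γ₁ Θ ≤ boundaryConditionGraph Γ₀ Γ₁ Θ' :=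
  Submodule.map_mono (Submodule.comap_mono h)

theorem exists_eq_boundaryConditionGraph {G : Submodule 𝕜 (ℋ × ℋ)}
    (hbot : boundaryConditionGraph Γ₀ Γ₁ ⊥ ≤ G) (hG : G ≤ A.graph) :
    ∃ Θ, G = boundaryConditionGraph Γ₀ Γ₁ Θ := by
  refine ⟨(G.comap (A.domain.subtype.prod A.toFun)).map (Γ₀.prod Γ₁), le_antisymm ?_ ?_⟩
  · intro p hp
    obtain ⟨f, hf, hf'⟩ := A.mem_graph_iff.1 (hG hp)
    have hfp : ((f : ℋ), A f) = p := Prod.ext hf hf'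
    exact ⟨f, ⟨f, (hfp ▸ hp : ((f : ℋ), A f) ∈ G), rfl⟩, hfp⟩
  · rintro _ ⟨f, ⟨g, hg, hgf⟩, rfl⟩
    have hdiff : ((↑(f - g) : ℋ), A (f - g)) ∈ G := hbot <| by
      rw [coe_apply_mem_boundaryConditionGraph, Submodule.mem_bot]
      exact ((Γ₀.prod Γ₁).map_sub f g).trans (sub_eq_zero.2 hgf.symm)
    have hsum := G.add_mem hdiff hg
    simpa [LinearPMap.map_sub] using hsum

theorem graph_eq_boundaryConditionGraph_iff {H : ℋ →ₗ.[𝕜] ℋ} (hH : H ≤ A) :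
    H.graph = boundaryConditionGraph Γ₀ Γ₁ Θ ↔
      (H.domain : Set ℋ) = {f | ∃ hf : f ∈ A.domain, (Γ₀ ⟨f, hf⟩, Γ₁ ⟨f, hf⟩) ∈ Θ} := by
  have hmem : ∀ f : A.domain, ((f : ℋ), A f) ∈ H.graph ↔ (f : ℋ) ∈ H.domain := fun f => by
    refine ⟨H.mem_domain_of_mem_graph, fun hf => H.mem_graph_iff.2 ⟨⟨f, hf⟩, rfl, hH.2 rfl⟩⟩
  constructor
  · intro h
    ext f
    refine ⟨fun hf => ⟨hH.1 hf, ?_⟩, fun ⟨hf, hΘ⟩ => ?_⟩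
    · rwa [← coe_apply_mem_boundaryConditionGraph, ← h, hmem]
    · rwa [← coe_apply_mem_boundaryConditionGraph, ← h, hmem] at hΘ
  · intro h
    refine Submodule.ext fun p => ⟨fun hp => ?_, ?_⟩
    · obtain ⟨f, hf, rfl⟩ := A.mem_graph_iff'.1 (LinearPMap.le_graph_of_le hH hp)
      rw [hmem] at hp
      exact coe_apply_mem_boundaryConditionGraph.2 (h.subset hp).2
    · rintro ⟨f, hf, rfl⟩
      exact (hmem f).2 (h.superset ⟨f.2, hf⟩)

/-- Green's identity for the boundary maps `Γ₀`, `Γ₁` of the operator `A`. -/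
def GreenIdentity (A : ℋ →ₗ.[𝕜] ℋ) (Γ₀ Γ₁ : A.domain →ₗ[𝕜] B) : Prop :=
  ∀ f g : A.domain, ⟪A f, (g : ℋ)⟫_𝕜 - ⟪(f : ℋ), A g⟫_𝕜 = ⟪Γ₁ f, Γ₀ g⟫_𝕜 - ⟪Γ₀ f, Γ₁ g⟫_𝕜

theorem GreenIdentity.boundaryConditionGraph_bot_le (green : GreenIdentity A Γ₀ Γ₁) :
    boundaryConditionGraph Γ₀ Γ₁ ⊥ ≤ A.graph.adjoint := by
  rintro _ ⟨f, hf, rfl⟩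
  obtain ⟨h0, h1⟩ := Prod.mk.inj hf
  refine mem_adjoint_iff_inner_eq.2 fun p hp => ?_
  obtain ⟨g, rfl⟩ := A.mem_graph_iff'.1 hp
  have := green f g
  rwa [h0, h1, inner_zero_left, inner_zero_left, sub_self, sub_eq_zero] at this

/-- `(B, Γ₀, Γ₁)` is a boundary triple for `A`. Instead of requiring that `A` is the adjoint of its
restriction to the joint kernel of the boundary maps, only the inclusion which does not follow from
Green's identity is part of the definition. -/
structure IsBoundaryTriple (A : ℋ →ₗ.[𝕜] ℋ) (Γ₀ Γ₁ : A.domain →ₗ[𝕜] B) : Prop where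
  green : GreenIdentity A Γ₀ Γ₁
  surjective : Function.Surjective (Γ₀.prod Γ₁)
  maximal : (boundaryConditionGraph Γ₀ Γ₁ ⊥).adjoint ≤ A.graph

namespace IsBoundaryTriple

theorem adjoint_boundaryConditionGraph (hT : IsBoundaryTriple A Γ₀ Γ₁) :
    (boundaryConditionGraph Γ₀ Γ₁ Θ).adjoint = boundaryConditionGraph Γ₀ Γ₁ Θ.adjoint := by
  have key : ∀ f : A.domain, ((f : ℋ), A f) ∈ (boundaryConditionGraph Γ₀ Γ₁ Θ).adjoint ↔
      (Γ₀ f, Γ₁ f) ∈ Θ.adjoint := fun f => by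
    have hgreen : ∀ g : A.domain, ⟪A f, (g : ℋ)⟫_𝕜 = ⟪(f : ℋ), A g⟫_𝕜 ↔
        ⟪Γ₁ f, Γ₀ g⟫_𝕜 = ⟪Γ₀ f, Γ₁ g⟫_𝕜 := fun g => by
      rw [← sub_eq_zero, hT.green f g, sub_eq_zero]
    rw [mem_adjoint_iff_inner_eq, mem_adjoint_iff_inner_eq]
    constructor
    · intro h p hp
      obtain ⟨g, rfl⟩ := hT.surjective p
      exact (hgreen g).1 (h _ ⟨g, hp, rfl⟩)
    · rintro h _ ⟨g, hg, rfl⟩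
      exact (hgreen g).2 (h _ hg)
  refine Submodule.ext fun p => ⟨fun hp => ?_, ?_⟩
  · obtain ⟨f, rfl⟩ := A.mem_graph_iff'.1
      (hT.maximal (adjoint_antitone (boundaryConditionGraph_mono bot_le) hp))
    exact coe_apply_mem_boundaryConditionGraph.2 ((key f).1 hp)
  · rintro ⟨f, hf, rfl⟩
    exact (key f).2 hf

theorem boundaryConditionGraph_injective (hT : IsBoundaryTriple A Γ₀ Γ₁) :
    Function.Injective (boundaryConditionGraph Γ₀ Γ₁) := fun Θ Θ' h => by
  refine Submodule.ext fun p => ?_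
  obtain ⟨f, rfl⟩ := hT.surjective p
  exact coe_apply_mem_boundaryConditionGraph.symm.trans
    (h ▸ coe_apply_mem_boundaryConditionGraph)

variable [CompleteSpace ℋ] {H : ℋ →ₗ.[𝕜] ℋ}

theorem isSelfAdjoint_iff_exists_relation (hT : IsBoundaryTriple A Γ₀ Γ₁) (hH : H ≤ A) :
    IsSelfAdjoint H ↔ ∃ Θ, Θ.adjoint = Θ ∧ H.graph = boundaryConditionGraph Γ₀ Γ₁ Θ := by
  rw [isSelfAdjoint_iff_adjoint_graph_eq]
  constructor
  · intro hadj
    have hle : H.graph ≤ A.graph := LinearPMap.le_graph_of_le hH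
    obtain ⟨Θ, hΘ⟩ := exists_eq_boundaryConditionGraph
      ((hT.green.boundaryConditionGraph_bot_le.trans (adjoint_antitone hle)).trans hadj.le) hle
    rw [hΘ, hT.adjoint_boundaryConditionGraph] at hadj
    exact ⟨Θ, hT.boundaryConditionGraph_injective hadj, hΘ⟩
  · rintro ⟨Θ, hadj, hΘ⟩
    rw [hΘ, hT.adjoint_boundaryConditionGraph, hadj]

theorem isSelfAdjoint_iff_exists_operator [CompleteSpace B] (hT : IsBoundaryTriple A Γ₀ Γ₁)
    (hH : H ≤ A) :
    IsSelfAdjoint H ↔ ∃ (X : Submodule 𝕜 B) (hX : IsClosed (X : Set B)),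
      haveI : CompleteSpace X := hX.completeSpace_coe
      ∃ L : X →ₗ.[𝕜] X, IsSelfAdjoint L ∧
        (H.domain : Set ℋ) = {f | ∃ (hf : f ∈ A.domain) (x : L.domain),
          ((x : X) : B) = Γ₀ ⟨f, hf⟩ ∧ L x = X.orthogonalProjectionOnto (Γ₁ ⟨f, hf⟩)} := by
  simp only [hT.isSelfAdjoint_iff_exists_relation hH, graph_eq_boundaryConditionGraph_iff hH]
  constructor
  · rintro ⟨Θ, hΘ, hdom⟩
    obtain ⟨X, hX, L, hL, rfl⟩ := adjoint_eq_self_iff_exists_isSelfAdjoint.1 hΘ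
    have : CompleteSpace X := hX.completeSpace_coe
    exact ⟨X, hX, L, hL, by simpa only [mem_liftRelation_graph] using hdom⟩
  · rintro ⟨X, hX, L, hL, hdom⟩
    have : CompleteSpace X := hX.completeSpace_coe
    exact ⟨_, adjoint_eq_self_iff_exists_isSelfAdjoint.2 ⟨X, hX, L, hL, rfl⟩,
      by simpa only [mem_liftRelation_graph] using hdom⟩

end IsBoundaryTriple

theorem exists_add_apply_eq_zero_of_neumann (hsurj : Function.Surjective Γ₁)
    (hneumann : ∀ h : ℋ, ∃ f : A.domain, Γ₁ f = 0 ∧ (f : ℋ) + A f = h) (u : B) :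
    ∃ h : A.domain, Γ₁ h = u ∧ (h : ℋ) + A h = 0 := by
  obtain ⟨h₀, rfl⟩ := hsurj u
  obtain ⟨n, hn, hnA⟩ := hneumann (h₀ + A h₀)
  refine ⟨h₀ - n, by rw [map_sub, hn, sub_zero], ?_⟩
  rw [LinearPMap.map_sub, Submodule.coe_sub, sub_add_sub_comm, hnA, sub_self]

theorem GreenIdentity.exists_coe_eq_of_inner_eq_zero [CompleteSpace B]
    (green : GreenIdentity A Γ₀ Γ₁) (hsurj : Function.Surjective Γ₁)
    (hneumann : ∀ h : ℋ, ∃ f : A.domain, Γ₁ f = 0 ∧ (f : ℋ) + A f = h) (T : B →L[𝕜] ℋ)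
    (hT : ∀ x, ∃ f : A.domain, Γ₀ f = x ∧ Γ₁ f = 0 ∧ (f : ℋ) + A f = T x) {z : ℋ}
    (hz : ∀ g : A.domain, Γ₀ g = 0 → Γ₁ g = 0 → ⟪z, (g : ℋ) + A g⟫_𝕜 = 0) :
    ∃ h : A.domain, (h : ℋ) = z ∧ (h : ℋ) + A h = 0 := by
  -- On `ker Γ₁` the functional `g ↦ ⟪z, g + A g⟫` factors through `Γ₀`; boundedness of `T` lets it
  -- be represented by some `χ`, and the solution `h` with `Γ₁ h = -χ` gives the same functional.
  let χ : B := (InnerProductSpace.toDual 𝕜 B).symm (innerSL 𝕜 z ∘L T)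
  have hχ : ∀ g : A.domain, Γ₁ g = 0 → ⟪z, (g : ℋ) + A g⟫_𝕜 = ⟪χ, Γ₀ g⟫_𝕜 := fun g hg => by
    obtain ⟨f, hf0, hf1, hf⟩ := hT (Γ₀ g)
    have hgf := hz (g - f) (by rw [map_sub, hf0, sub_self]) (by rw [map_sub, hg, hf1, sub_self])
    rw [LinearPMap.map_sub, Submodule.coe_sub, sub_add_sub_comm, hf, inner_sub_right] at hgf
    simpa [χ] using sub_eq_zero.1 hgf
  obtain ⟨h, hh1, hh⟩ := exists_add_apply_eq_zero_of_neumann hsurj hneumann (-χ)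
  have hh' : ∀ g : A.domain, Γ₁ g = 0 → ⟪(h : ℋ), (g : ℋ) + A g⟫_𝕜 = ⟪χ, Γ₀ g⟫_𝕜 := fun g hg => by
    have hgreen := green h g
    rw [eq_neg_of_add_eq_zero_right hh, hh1, hg, inner_zero_right, inner_neg_left,
      inner_neg_left] at hgreen
    rw [inner_add_right]
    linear_combination -hgreen
  obtain ⟨g, hg1, hg⟩ := hneumann (z - h)
  have hzh : ⟪z - h, z - h⟫_𝕜 = 0 := by
    nth_rw 2 [← hg]
    rw [inner_sub_left, hχ g hg1, hh' g hg1, sub_self]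
  exact ⟨h, (sub_eq_zero.1 (inner_self_eq_zero.1 hzh)).symm, hh⟩

theorem IsBoundaryTriple.of_neumann [CompleteSpace B] (green : GreenIdentity A Γ₀ Γ₁)
    (hsurj : Function.Surjective Γ₁)
    (hneumann : ∀ h : ℋ, ∃ f : A.domain, Γ₁ f = 0 ∧ (f : ℋ) + A f = h) (T : B →L[𝕜] ℋ)
    (hT : ∀ x, ∃ f : A.domain, Γ₀ f = x ∧ Γ₁ f = 0 ∧ (f : ℋ) + A f = T x) :
    IsBoundaryTriple A Γ₀ Γ₁ where
  green := green
  surjective := fun ⟨x, u⟩ => by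
    obtain ⟨f, hf⟩ := hsurj u
    obtain ⟨g, hg0, hg1, -⟩ := hT (x - Γ₀ f)
    exact ⟨f + g, by simp [hg0, hg1, hf]⟩
  maximal := fun ⟨y, w⟩ hyw => by
    rw [mem_adjoint_iff_inner_eq] at hyw
    obtain ⟨f, -, hf⟩ := hneumann (y + w)
    have hz : ∀ g : A.domain, Γ₀ g = 0 → Γ₁ g = 0 → ⟪y - f, (g : ℋ) + A g⟫_𝕜 = 0 := by
      intro g hg0 hg1
      have hgreen := green f g
      rw [hg0, hg1, inner_zero_right, inner_zero_right, sub_self] at hgreen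
      have hfg : ⟪(f : ℋ) + A f, (g : ℋ)⟫_𝕜 = ⟪y + w, (g : ℋ)⟫_𝕜 := by rw [hf]
      rw [inner_add_left, inner_add_left] at hfg
      rw [inner_sub_left, inner_add_right, inner_add_right]
      have hwy : ⟪w, (g : ℋ)⟫_𝕜 = ⟪y, A g⟫_𝕜 := hyw _ ⟨g, Prod.ext hg0 hg1, rfl⟩
      linear_combination hgreen - hfg - hwy
    obtain ⟨h, hh, hhA⟩ := green.exists_coe_eq_of_inner_eq_zero hsurj hneumann T hT hz
    have hy : ((f + h : A.domain) : ℋ) = y := by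
      rw [Submodule.coe_add, hh, add_sub_cancel]
    refine A.mem_graph_iff.2 ⟨f + h, hy, add_left_cancel (a := y) ?_⟩
    nth_rw 1 [← hy]
    rw [LinearPMap.map_add, Submodule.coe_add, add_add_add_comm, hf, hhA, add_zero]

end BoundaryTriple

/-! ### Primitives and Green's identity on an edge -/

section Primitive

variable {𝕜 X Y : Type*} [RCLike 𝕜] [NormedAddCommGroup X] [NormedSpace ℝ X]
  [NormedAddCommGroup Y] [NormedSpace ℝ Y]
  {F g : ℝ → X}

/-- `F` is a primitive of the locally integrable function `g`, that is, `F` is locally absolutely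
continuous with derivative `g` almost everywhere. -/
structure IsPrimitive (F g : ℝ → X) : Prop where
  locallyIntegrable : LocallyIntegrable g
  sub_eq_integral : ∀ x y, F y - F x = ∫ t in x..y, g t

namespace IsPrimitive

theorem intervalIntegrable (h : IsPrimitive F g) (x y : ℝ) : IntervalIntegrable g volume x y :=
  (h.locallyIntegrable.integrableOn_isCompact isCompact_uIcc).intervalIntegrable

theorem eq_integral_add (h : IsPrimitive F g) (x y : ℝ) : F y = (∫ t in x..y, g t) + F x := by
  rw [← h.sub_eq_integral, sub_add_cancel]

protected theorem continuous (h : IsPrimitive F g) : Continuous F := by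
  rw [funext (h.eq_integral_add 0)]
  exact (intervalIntegral.continuous_primitive h.intervalIntegrable 0).add_const _

theorem ae_hasDerivAt [CompleteSpace X] (h : IsPrimitive F g) : ∀ᵐ x, HasDerivAt F (g x) x := by
  filter_upwards [LocallyIntegrable.ae_hasDerivAt_integral h.locallyIntegrable] with x hx
  rw [funext (h.eq_integral_add 0)]
  exact (hx 0).add_const _

theorem absolutelyContinuousOnInterval (h : IsPrimitive F g) (a b : ℝ) :
    AbsolutelyContinuousOnInterval F a b := by
  have hdist : ∀ x y, dist (F x) (F y) ≤
      dist (∫ t in a..x, ‖g t‖) (∫ t in a..y, ‖g t‖) := fun x y => by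
    rw [dist_comm (F x), dist_comm (∫ t in a..x, ‖g t‖), dist_eq_norm, dist_eq_norm,
      h.sub_eq_integral, Real.norm_eq_abs, intervalIntegral.integral_interval_sub_left
        (h.intervalIntegrable _ _).norm (h.intervalIntegrable _ _).norm]
    exact intervalIntegral.norm_integral_le_abs_integral_norm
  exact squeeze_zero (fun _ => Finset.sum_nonneg fun _ _ => dist_nonneg)
    (fun _ => Finset.sum_le_sum fun _ _ => hdist _ _)
    ((h.intervalIntegrable a b).norm.absolutelyContinuousOnInterval_intervalIntegral left_mem_uIcc)

theorem of_absolutelyContinuous [CompleteSpace X] (hg : LocallyIntegrable g)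
    (hac : ∀ a b, AbsolutelyContinuousOnInterval F a b) (hderiv : ∀ᵐ x, HasDerivAt F (g x) x) :
    IsPrimitive F g where
  locallyIntegrable := hg
  sub_eq_integral x y := by
    have hG : IsPrimitive (fun s => ∫ t in x..s, g t) g := ⟨hg, fun a b =>
      have hi : ∀ c d, IntervalIntegrable g volume c d := fun c d =>
        (hg.integrableOn_isCompact isCompact_uIcc).intervalIntegrable
      intervalIntegral.integral_interval_sub_left (hi _ _) (hi _ _)⟩
    obtain ⟨C, hC⟩ := ((hac x y).sub (hG.absolutelyContinuousOnInterval x y)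
      ).const_of_ae_hasDerivAt_zero <| by
        filter_upwards [hderiv, hG.ae_hasDerivAt] with s hF hG _
        simpa using hF.sub hG
    have hx := hC x left_mem_uIcc
    have hy := hC y right_mem_uIcc
    simp only [Pi.sub_apply, intervalIntegral.integral_same, sub_zero] at hx hy
    rw [hx, ← hy, sub_sub_cancel]

theorem clm_comp [CompleteSpace X] [CompleteSpace Y] (h : IsPrimitive F g) (A : X →L[ℝ] Y) :
    IsPrimitive (fun x => A (F x)) fun x => A (g x) where
  locallyIntegrable x := (h.locallyIntegrable x).imp fun _ hs => ⟨hs.1, A.integrable_comp hs.2⟩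
  sub_eq_integral x y := by
    rw [← map_sub, h.sub_eq_integral, A.intervalIntegral_comp_comm (h.intervalIntegrable x y)]

theorem mul {F f G g : ℝ → 𝕜} (hF : IsPrimitive F f) (hG : IsPrimitive G g) :
    IsPrimitive (fun x => F x * G x) fun x => f x * G x + F x * g x := by
  refine of_absolutelyContinuous ?_ (fun a b => (hF.absolutelyContinuousOnInterval a b).fun_smul
    (hG.absolutelyContinuousOnInterval a b)) ?_
  · exact (hF.locallyIntegrable.mul_continuous hG.continuous).add
      (hG.locallyIntegrable.continuous_mul hF.continuous)
  · filter_upwards [hF.ae_hasDerivAt, hG.ae_hasDerivAt] with x hx hy using hx.mul hy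

theorem inner {F f G g : ℝ → 𝕜} (hF : IsPrimitive F f) (hG : IsPrimitive G g) :
    IsPrimitive (fun x => ⟪F x, G x⟫_𝕜) fun x => ⟪f x, G x⟫_𝕜 + ⟪F x, g x⟫_𝕜 := by
  simpa [RCLike.inner_apply, mul_comm] using
    (hF.clm_comp RCLike.conjCLE.toContinuousLinearMap).mul hG

theorem tendsto_atTop {b : EReal} (h : IsPrimitive F g) (hg : Integrable g)
    (hzero : ∀ x : ℝ, b ≤ x → g x = 0) (hF : b = ⊤ → IntegrableAtFilter F atTop) :
    Tendsto F atTop (𝓝 (if b < ⊤ then F b.toReal else 0)) := by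
  split_ifs with hb
  · refine tendsto_const_nhds.congr' ?_
    filter_upwards [eventually_ge_atTop b.toReal] with x hx
    rw [eq_comm, ← sub_eq_zero, h.sub_eq_integral, intervalIntegral.integral_of_le hx]
    exact setIntegral_eq_zero_of_forall_eq_zero fun t ht => hzero t <|
      (EReal.le_coe_toReal hb.ne).trans (EReal.coe_le_coe_iff.2 ht.1.le)
  · have hlim : Tendsto F atTop (𝓝 ((∫ x in Ioi 0, g x) + F 0)) :=
      ((intervalIntegral_tendsto_integral_Ioi 0 hg.integrableOn tendsto_id).add_const _).congr
        fun x => (h.eq_integral_add 0 x).symm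
    rwa [(hF (not_lt_top_iff.1 hb)).eq_zero_of_tendsto (fun s hs => ?_) hlim] at hlim
    obtain ⟨c, hc⟩ := mem_atTop_sets.1 hs
    exact measure_mono_top (fun x hx => hc x hx) (Real.volume_Ici (a := c))

theorem tendsto_atBot {a : EReal} (h : IsPrimitive F g) (hg : Integrable g)
    (hzero : ∀ x : ℝ, x ≤ a → g x = 0) (hF : a = ⊥ → IntegrableAtFilter F atBot) :
    Tendsto F atBot (𝓝 (if ⊥ < a then F a.toReal else 0)) := by
  split_ifs with ha
  · refine tendsto_const_nhds.congr' ?_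
    filter_upwards [eventually_le_atBot a.toReal] with x hx
    rw [← sub_eq_zero, h.sub_eq_integral, intervalIntegral.integral_of_le hx]
    exact setIntegral_eq_zero_of_forall_eq_zero fun t ht => hzero t <|
      (EReal.coe_le_coe_iff.2 ht.2).trans (EReal.coe_toReal_le ha.ne')
  · have hlim : Tendsto F atBot (𝓝 (F 0 - ∫ x in Iic 0, g x)) :=
      ((intervalIntegral_tendsto_integral_Iic 0 hg.integrableOn tendsto_id).const_sub _).congr
        fun x => by rw [id, ← h.sub_eq_integral, sub_sub_cancel]
    rwa [(hF (not_bot_lt_iff.1 ha)).eq_zero_of_tendsto (fun s hs => ?_) hlim] at hlim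
    obtain ⟨c, hc⟩ := mem_atBot_sets.1 hs
    exact measure_mono_top (fun x hx => hc x hx) (Real.volume_Iic (a := c))

theorem integral_eq_boundary {a b : EReal} (h : IsPrimitive F g) (hg : Integrable g)
    (ha : ∀ x : ℝ, x ≤ a → g x = 0) (hb : ∀ x : ℝ, b ≤ x → g x = 0)
    (hFa : a = ⊥ → IntegrableAtFilter F atBot) (hFb : b = ⊤ → IntegrableAtFilter F atTop) :
    ∫ x, g x = (if b < ⊤ then F b.toReal else 0) - (if ⊥ < a then F a.toReal else 0) := by
  refine tendsto_nhds_unique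
    (intervalIntegral_tendsto_integral hg tendsto_neg_atTop_atBot tendsto_id) ?_
  simp_rw [← h.sub_eq_integral]
  exact (h.tendsto_atTop hg hb hFb).sub ((h.tendsto_atBot hg ha hFa).comp tendsto_neg_atTop_atBot)

end IsPrimitive

end Primitive

section Edge

variable {𝕜 : Type*} [RCLike 𝕜] {I : Set ℝ}

theorem IsWeakDeriv.exists_isPrimitive (hI : IsOpen I) (hc : I.OrdConnected)
    {f f' : Lp 𝕜 2 (volume.restrict I)} (h : IsWeakDeriv I f f') :
    ∃ F : ℝ → 𝕜, F =ᵐ[volume.restrict I] f ∧ IsPrimitive F (I.indicator f') ∧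
      ∀ x ∈ closure I, boundaryValue I f x = F x := by
  obtain ⟨F, hF, hFf, hFf'⟩ := h.exists_continuous hI hc
  exact ⟨F, hFf, ⟨locInt f' hI.measurableSet, hFf'⟩, fun x hx =>
    boundaryValue_eq hI hF.continuousOn hFf hx⟩

end Edge

namespace MetricGraph

variable {V E : Type*} {Γ : MetricGraph V E} {𝕜 : Type*} [RCLike 𝕜]

theorem left_mem_closure_edge {e : E} (h : ⊥ < Γ.a e) :
    (Γ.a e).toReal ∈ closure (Γ.edge e) := by
  have hab := Γ.a_lt_b e
  lift Γ.a e to ℝ using ⟨hab.ne_top, h.ne'⟩ with a ha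
  obtain ⟨c, hac, hcb⟩ := EReal.lt_iff_exists_real_btwn.1 hab
  have hac' : a < c := EReal.coe_lt_coe_iff.1 hac
  have hsub : Ioo a c ⊆ Γ.edge e := fun x hx =>
    ⟨ha ▸ EReal.coe_lt_coe_iff.2 hx.1, (EReal.coe_lt_coe_iff.2 hx.2).trans hcb⟩
  exact closure_mono hsub (closure_Ioo hac'.ne ▸ left_mem_Icc.2 hac'.le)

theorem right_mem_closure_edge {e : E} (h : Γ.b e < ⊤) :
    (Γ.b e).toReal ∈ closure (Γ.edge e) := by
  have hab := Γ.a_lt_b e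
  lift Γ.b e to ℝ using ⟨h.ne, hab.ne_bot⟩ with b hb
  obtain ⟨c, hac, hcb⟩ := EReal.lt_iff_exists_real_btwn.1 hab
  have hcb' : c < b := EReal.coe_lt_coe_iff.1 hcb
  have hsub : Ioo c b ⊆ Γ.edge e := fun x hx =>
    ⟨hac.trans (EReal.coe_lt_coe_iff.2 hx.1), hb ▸ EReal.coe_lt_coe_iff.2 hx.2⟩
  exact closure_mono hsub (closure_Ioo hcb'.ne ▸ right_mem_Icc.2 hcb'.le)

theorem edge_mem_atBot {e : E} (h : Γ.a e = ⊥) : Γ.edge e ∈ atBot := by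
  obtain ⟨c, -, hcb⟩ := EReal.lt_iff_exists_real_btwn.1 (Γ.a_lt_b e)
  filter_upwards [Iio_mem_atBot c] with x hx
  exact ⟨h ▸ EReal.bot_lt_coe x, (EReal.coe_lt_coe_iff.2 hx).trans hcb⟩

theorem edge_mem_atTop {e : E} (h : Γ.b e = ⊤) : Γ.edge e ∈ atTop := by
  obtain ⟨c, hac, -⟩ := EReal.lt_iff_exists_real_btwn.1 (Γ.a_lt_b e)
  filter_upwards [Ioi_mem_atTop c] with x hx
  exact ⟨hac.trans (EReal.coe_lt_coe_iff.2 hx), h ▸ EReal.coe_lt_top x⟩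

theorem integral_edge_eq_boundary {X : Type*} [NormedAddCommGroup X] [NormedSpace ℝ X] {e : E}
    {P p : ℝ → X} (hP : IsPrimitive P ((Γ.edge e).indicator p)) (hp : IntegrableOn p (Γ.edge e))
    (hPi : IntegrableOn P (Γ.edge e)) :
    ∫ x in Γ.edge e, p x = (if Γ.b e < ⊤ then P (Γ.b e).toReal else 0) -
      (if ⊥ < Γ.a e then P (Γ.a e).toReal else 0) := by
  have hI := (Γ.isOpen_edge e).measurableSet
  rw [← integral_indicator hI]
  exact hP.integral_eq_boundary ((integrable_indicator_iff hI).2 hp)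
    (fun x hx => indicator_of_notMem (fun h => h.1.not_ge hx) _)
    (fun x hx => indicator_of_notMem (fun h => h.2.not_ge hx) _)
    (fun h => ⟨_, edge_mem_atBot h, hPi⟩) (fun h => ⟨_, edge_mem_atTop h, hPi⟩)

theorem inner_add_inner_eq_boundaryValue {e : E} {f f' g g' : Lp 𝕜 2 (volume.restrict (Γ.edge e))}
    (hf : IsWeakDeriv (Γ.edge e) f f') (hg : IsWeakDeriv (Γ.edge e) g g') :
    ⟪f', g⟫_𝕜 + ⟪f, g'⟫_𝕜 =
      (if Γ.b e < ⊤ then ⟪boundaryValue (Γ.edge e) f (Γ.b e).toReal,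
        boundaryValue (Γ.edge e) g (Γ.b e).toReal⟫_𝕜 else 0) -
      (if ⊥ < Γ.a e then ⟪boundaryValue (Γ.edge e) f (Γ.a e).toReal,
        boundaryValue (Γ.edge e) g (Γ.a e).toReal⟫_𝕜 else 0) := by
  obtain ⟨F, hFf, hF, hFb⟩ := hf.exists_isPrimitive (Γ.isOpen_edge e) (Γ.ordConnected_edge e)
  obtain ⟨G, hGg, hG, hGb⟩ := hg.exists_isPrimitive (Γ.isOpen_edge e) (Γ.ordConnected_edge e)
  have hFG : IsPrimitive (fun x => ⟪F x, G x⟫_𝕜)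
      ((Γ.edge e).indicator fun x => ⟪f' x, G x⟫_𝕜 + ⟪F x, g' x⟫_𝕜) := by
    convert hF.inner hG using 2 with x
    by_cases hx : x ∈ Γ.edge e <;> simp [hx]
  have hderiv : (fun x => ⟪f' x, g x⟫_𝕜 + ⟪f x, g' x⟫_𝕜) =ᵐ[volume.restrict (Γ.edge e)]
      fun x => ⟪f' x, G x⟫_𝕜 + ⟪F x, g' x⟫_𝕜 := by
    filter_upwards [hFf, hGg] with x hx hy using by rw [hx, hy]
  have hint : IntegrableOn (fun x => ⟪f' x, G x⟫_𝕜 + ⟪F x, g' x⟫_𝕜) (Γ.edge e) :=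
    ((L2.integrable_inner f' g).add (L2.integrable_inner f g')).congr hderiv
  have hFGi : IntegrableOn (fun x => ⟪F x, G x⟫_𝕜) (Γ.edge e) :=
    (L2.integrable_inner f g).congr <| by
      filter_upwards [hFf, hGg] with x hx hy using by rw [hx, hy]
  rw [L2.inner_def, L2.inner_def, ← integral_add (L2.integrable_inner _ _)
    (L2.integrable_inner _ _), integral_congr_ae hderiv, integral_edge_eq_boundary hFG hint hFGi]
  congr 1
  · split_ifs with hb
    · rw [hFb _ (right_mem_closure_edge hb), hGb _ (right_mem_closure_edge hb)]
    · rfl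
  · split_ifs with ha
    · rw [hFb _ (left_mem_closure_edge ha), hGb _ (left_mem_closure_edge ha)]
    · rfl

end MetricGraph

/-! ### Green's identity on the graph -/

namespace MetricGraph

section EndpointSum

variable {V E M : Type*} (Γ : MetricGraph V E)

open Classical in
/-- The value of the family `φ` at the left endpoint of the edge `e`, or `0` if `aₑ = -∞`. -/
noncomputable def leftValue [Zero M] (φ : Γ.Endpoint → M) (e : E) : M :=
  if h : ⊥ < Γ.a e then φ (.inl ⟨e, h⟩) else 0

open Classical in
/-- The value of the family `φ` at the right endpoint of the edge `e`, or `0` if `bₑ = ∞`. -/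
noncomputable def rightValue [Zero M] (φ : Γ.Endpoint → M) (e : E) : M :=
  if h : Γ.b e < ⊤ then φ (.inr ⟨e, h⟩) else 0

theorem hasSum_leftValue_add_rightValue [NormedAddCommGroup M] [CompleteSpace M]
    {φ : Γ.Endpoint → M} {s : M} (h : HasSum φ s) :
    HasSum (fun e => Γ.leftValue φ e + Γ.rightValue φ e) s := by
  have hl := (h.summable.comp_injective Sum.inl_injective).hasSum
  have hr := (h.summable.comp_injective Sum.inr_injective).hasSum
  rw [h.unique (HasSum.sum hl hr)]
  refine .add ((hasSum_subtype_iff_of_support_subset (s := {e | ⊥ < Γ.a e})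
      fun e he => by_contra fun h => he (dif_neg h)).1 ?_)
    ((hasSum_subtype_iff_of_support_subset (s := {e | Γ.b e < ⊤})
      fun e he => by_contra fun h => he (dif_neg h)).1 ?_)
  · exact hl.congr_fun fun e => dif_pos e.2
  · exact hr.congr_fun fun e => dif_pos e.2

end EndpointSum

section Green

variable {V E : Type*} {Γ : MetricGraph V E} {𝕜 : Type*} [RCLike 𝕜]

theorem inner_weakDeriv_add_inner_weakDeriv (hΓ : 0 < ⨅ e, (Γ.b e - Γ.a e)) (f g : Γ.W1 𝕜) :
    ⟪Γ.weakDeriv f, (g : Γ.Space 𝕜)⟫_𝕜 + ⟪(f : Γ.Space 𝕜), Γ.weakDeriv g⟫_𝕜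
      = -⟪Γ.signedTrace hΓ f, Γ.trace hΓ g⟫_𝕜 := by
  have hedges := (lp.hasSum_inner (𝕜 := 𝕜) (Γ.weakDeriv f) (g : Γ.Space 𝕜)).add
    (lp.hasSum_inner (𝕜 := 𝕜) (f : Γ.Space 𝕜) (Γ.weakDeriv g))
  have hends := (Γ.hasSum_leftValue_add_rightValue
    (lp.hasSum_inner (𝕜 := 𝕜) (Γ.signedTrace hΓ f) (Γ.trace hΓ g))).neg
  refine hedges.unique (hends.congr_fun fun e => ?_)
  rw [inner_add_inner_eq_boundaryValue (Γ.hasWeakDeriv_weakDeriv f e)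
    (Γ.hasWeakDeriv_weakDeriv g e)]
  simp only [leftValue, rightValue, signedTrace, trace, signedBoundaryValues, boundaryValues,
    LinearMap.coe_mk, AddHom.coe_mk, inner_neg_left]
  split_ifs <;> ring

theorem inner_maximalLaplacian_left (hΓ : 0 < ⨅ e, (Γ.b e - Γ.a e))
    (f : (Γ.maximalLaplacian 𝕜).domain) (g : Γ.W1 𝕜) :
    ⟪Γ.maximalLaplacian 𝕜 f, (g : Γ.Space 𝕜)⟫_𝕜 =
      ⟪(Γ.firstDeriv f : Γ.Space 𝕜), Γ.weakDeriv g⟫_𝕜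
        + ⟪Γ.signedTrace hΓ (Γ.firstDeriv f), Γ.trace hΓ g⟫_𝕜 := by
  have hparts := inner_weakDeriv_add_inner_weakDeriv hΓ (Γ.firstDeriv f) g
  have happly : Γ.maximalLaplacian 𝕜 f = -Γ.weakDeriv (Γ.firstDeriv f) := rfl
  rw [happly, inner_neg_left]
  linear_combination -hparts

theorem inner_maximalLaplacian_right (hΓ : 0 < ⨅ e, (Γ.b e - Γ.a e))
    (f : Γ.W1 𝕜) (g : (Γ.maximalLaplacian 𝕜).domain) :
    ⟪(f : Γ.Space 𝕜), Γ.maximalLaplacian 𝕜 g⟫_𝕜 =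
      ⟪Γ.weakDeriv f, (Γ.firstDeriv g : Γ.Space 𝕜)⟫_𝕜
        + ⟪Γ.trace hΓ f, Γ.signedTrace hΓ (Γ.firstDeriv g)⟫_𝕜 := by
  rw [← inner_conj_symm, inner_maximalLaplacian_left hΓ, map_add, inner_conj_symm, inner_conj_symm]

theorem greenIdentity_maximalLaplacian (hΓ : 0 < ⨅ e, (Γ.b e - Γ.a e)) :
    GreenIdentity (Γ.maximalLaplacian 𝕜) (Γ.trace hΓ ∘ₗ Γ.toW1)
      (Γ.signedTrace hΓ ∘ₗ Γ.firstDeriv) := by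
  intro f g
  have hleft := inner_maximalLaplacian_left hΓ f (Γ.toW1 g)
  have hright := inner_maximalLaplacian_right hΓ (Γ.toW1 f) g
  exact (congrArg₂ (· - ·) hleft hright).trans (add_sub_add_left_eq_sub _ _ _)

end Green

end MetricGraph

/-! ### Test functions and weak derivatives -/

section TestFunction

variable {𝕜 : Type*} [RCLike 𝕜] {I s t : Set ℝ} {φ ψ : ℝ → ℝ}

/-- `φ` is a real test function on the set `s`, extended by `0` to `ℝ`. -/
structure IsTestFunction (s : Set ℝ) (φ : ℝ → ℝ) : Prop where
  contDiff : ContDiff ℝ ∞ φ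
  hasCompactSupport : HasCompactSupport φ
  tsupport_subset : tsupport φ ⊆ s

namespace IsTestFunction

protected theorem continuous (h : IsTestFunction s φ) : Continuous φ :=
  h.contDiff.continuous

protected theorem hasDerivAt (h : IsTestFunction s φ) (x : ℝ) : HasDerivAt φ (deriv φ x) x :=
  (h.contDiff.differentiable (by simp) x).hasDerivAt

theorem eq_zero (h : IsTestFunction s φ) {x : ℝ} (hx : x ∉ s) : φ x = 0 :=
  image_eq_zero_of_notMem_tsupport fun hφ => hx (h.tsupport_subset hφ)

protected theorem neg (h : IsTestFunction s φ) : IsTestFunction s (-φ) where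
  contDiff := h.contDiff.neg
  hasCompactSupport := h.hasCompactSupport.neg
  tsupport_subset := by rw [tsupport_neg]; exact h.tsupport_subset

protected theorem deriv (h : IsTestFunction s φ) : IsTestFunction s (deriv φ) where
  contDiff := (contDiff_infty_iff_deriv.1 h.contDiff).2
  hasCompactSupport := h.hasCompactSupport.deriv
  tsupport_subset := tsupport_deriv_subset.trans h.tsupport_subset

theorem contDiff_mul (hψ : ContDiff ℝ ∞ ψ) (h : IsTestFunction s φ) :
    IsTestFunction s (ψ * φ) where
  contDiff := hψ.mul h.contDiff
  hasCompactSupport := h.hasCompactSupport.mul_left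
  tsupport_subset := tsupport_mul_subset_right.trans h.tsupport_subset

theorem comp_sub_const (h : IsTestFunction s φ) (z : ℝ) :
    IsTestFunction univ fun x => φ (x - z) where
  contDiff := h.contDiff.comp (contDiff_id.sub contDiff_const)
  hasCompactSupport := h.hasCompactSupport.comp_homeomorph (Homeomorph.subRight z)
  tsupport_subset := subset_univ _

theorem comp_const_sub (h : IsTestFunction s φ) (z : ℝ) :
    IsTestFunction univ fun x => φ (z - x) where
  contDiff := h.contDiff.comp (contDiff_const.sub contDiff_id)
  hasCompactSupport := h.hasCompactSupport.comp_homeomorph (Homeomorph.subLeft z)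
  tsupport_subset := subset_univ _

theorem memLp_ofReal (h : IsTestFunction s φ) :
    MemLp (fun x => (φ x : 𝕜)) 2 (volume.restrict I) :=
  ((h.continuous.memLp_of_hasCompactSupport h.hasCompactSupport).restrict I).ofReal

theorem integral_deriv_mul (hψ : IsTestFunction t ψ) (hφ : IsTestFunction s φ) :
    ∫ x, deriv ψ x * φ x = -∫ x, ψ x * deriv φ x := by
  rw [integral_mul_deriv_eq_deriv_mul_of_integrable (fun x _ => hψ.hasDerivAt x)
    (fun x _ => hφ.hasDerivAt x), neg_neg]
  · exact (hψ.continuous.mul hφ.deriv.continuous).integrable_of_hasCompactSupport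
      hψ.hasCompactSupport.mul_right
  · exact (hψ.deriv.continuous.mul hφ.continuous).integrable_of_hasCompactSupport
      hφ.hasCompactSupport.mul_left
  · exact (hψ.continuous.mul hφ.continuous).integrable_of_hasCompactSupport
      hφ.hasCompactSupport.mul_left

end IsTestFunction

theorem exists_isTestFunction_eq_one_deriv_eq_zero {r : ℝ} (hr : 0 < r) :
    ∃ ρ : ℝ → ℝ, IsTestFunction (Ioo (-r) r) ρ ∧ ρ 0 = 1 ∧ deriv ρ 0 = 0 := by
  let B : ContDiffBump (0 : ℝ) := ⟨r / 4, r / 2, by positivity, by linarith⟩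
  refine ⟨B, ⟨B.contDiff, B.hasCompactSupport, ?_⟩, ?_, ?_⟩
  · rw [B.tsupport_eq, Real.closedBall_eq_Icc, zero_sub, zero_add]
    exact Icc_subset_Ioo (neg_lt_neg (half_lt_self hr)) (half_lt_self hr)
  · exact B.one_of_mem_closedBall (Metric.mem_closedBall_self B.rIn_pos.le)
  · have hone : B =ᶠ[𝓝 (0 : ℝ)] fun _ => (1 : ℝ) :=
      B.eventuallyEq_one_of_mem_ball (Metric.mem_ball_self B.rIn_pos)
    rw [hone.deriv_eq, deriv_const]

open Classical in
/-- The class in `L₂(I)` of the restriction of `φ` to `I`. It is defined as `0` if this restriction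
is not square integrable, so that no proof has to be carried in the term. -/
noncomputable def toL2 (𝕜 : Type*) [RCLike 𝕜] (I : Set ℝ) (φ : ℝ → ℝ) :
    Lp 𝕜 2 (volume.restrict I) :=
  if h : MemLp (fun x => (φ x : 𝕜)) 2 (volume.restrict I) then h.toLp else 0

namespace IsTestFunction

theorem coeFn_toL2 (h : IsTestFunction s φ) :
    toL2 𝕜 I φ =ᵐ[volume.restrict I] fun x => (φ x : 𝕜) := by
  rw [toL2, dif_pos h.memLp_ofReal]
  exact MemLp.coeFn_toLp _

theorem inner_toL2 (h : IsTestFunction s φ) (f : Lp 𝕜 2 (volume.restrict I)) :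
    ⟪toL2 𝕜 I φ, f⟫_𝕜 = ∫ x in I, φ x • f x := by
  rw [L2.inner_def]
  refine integral_congr_ae ?_
  filter_upwards [h.coeFn_toL2 (𝕜 := 𝕜)] with x hx
  rw [hx, RCLike.inner_apply, RCLike.conj_ofReal, RCLike.real_smul_eq_coe_mul, mul_comm]

theorem norm_toL2_sq_le (h : IsTestFunction s φ) : ‖toL2 𝕜 I φ‖ ^ 2 ≤ ∫ x, φ x ^ 2 := by
  have hnorm : ‖toL2 𝕜 I φ‖ ^ 2 = ∫ x in I, φ x ^ 2 := by
    rw [norm_sq_eq]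
    refine integral_congr_ae ?_
    filter_upwards [h.coeFn_toL2 (𝕜 := 𝕜)] with x hx
    rw [hx, RCLike.norm_ofReal, sq_abs]
  rw [hnorm]
  exact setIntegral_le_integral
    (h.continuous.memLp_of_hasCompactSupport h.hasCompactSupport).integrable_sq
    (Eventually.of_forall fun x => sq_nonneg _)

theorem setIntegral_smul_toL2 (h : IsTestFunction s φ) (hψ : tsupport ψ ⊆ I) :
    ∫ x in I, ψ x • toL2 𝕜 I φ x = ((∫ x, ψ x * φ x : ℝ) : 𝕜) := by
  have hzero : ∀ x, x ∉ I → ψ x * φ x = 0 := fun x hx => by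
    rw [image_eq_zero_of_notMem_tsupport fun hxψ => hx (hψ hxψ), zero_mul]
  rw [← setIntegral_eq_integral_of_forall_compl_eq_zero hzero, ← integral_ofReal]
  refine integral_congr_ae ?_
  filter_upwards [h.coeFn_toL2 (𝕜 := 𝕜)] with x hx
  rw [hx, RCLike.real_smul_eq_coe_mul, RCLike.ofReal_mul]

theorem isWeakDeriv_toL2 (h : IsTestFunction s φ) :
    IsWeakDeriv I (toL2 𝕜 I φ) (toL2 𝕜 I (deriv φ)) := by
  intro ψ hψ hψc hψI
  have hψ' : IsTestFunction I ψ := ⟨hψ, hψc, hψI⟩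
  rw [h.setIntegral_smul_toL2 hψ'.deriv.tsupport_subset, h.deriv.setIntegral_smul_toL2 hψI,
    hψ'.integral_deriv_mul h, RCLike.ofReal_neg]

theorem boundaryValue_toL2 (hI : IsOpen I) (h : IsTestFunction s φ) {z : ℝ}
    (hz : z ∈ closure I) : boundaryValue I (toL2 𝕜 I φ) z = φ z :=
  boundaryValue_eq (F := fun x => (φ x : 𝕜)) hI
    (RCLike.continuous_ofReal.comp h.continuous).continuousOn h.coeFn_toL2.symm hz

end IsTestFunction

theorem isWeakDeriv_iff_inner_toL2 {f g : Lp 𝕜 2 (volume.restrict I)} :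
    IsWeakDeriv I f g ↔ ∀ φ : ℝ → ℝ, IsTestFunction I φ →
      ⟪toL2 𝕜 I (deriv φ), f⟫_𝕜 = -⟪toL2 𝕜 I φ, g⟫_𝕜 := by
  refine ⟨fun h φ hφ => ?_, fun h φ hφ hφc hφI => ?_⟩
  · rw [hφ.deriv.inner_toL2, hφ.inner_toL2]
    exact h φ hφ.contDiff hφ.hasCompactSupport hφ.tsupport_subset
  · have hφ' : IsTestFunction I φ := ⟨hφ, hφc, hφI⟩
    rw [← hφ'.deriv.inner_toL2, ← hφ'.inner_toL2]
    exact h φ hφ'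

theorem isWeakDeriv_zero : IsWeakDeriv I (0 : Lp 𝕜 2 (volume.restrict I)) 0 :=
  isWeakDeriv_iff_inner_toL2.2 fun φ _ => by rw [inner_zero_right, inner_zero_right, neg_zero]

end TestFunction

/-! ### Extension of boundary values -/

namespace MetricGraph

section Extension

variable {V E : Type*} (Γ : MetricGraph V E) {𝕜 : Type*} [RCLike 𝕜] {s t : Set ℝ} {ρ σ : ℝ → ℝ}

theorem leftValue_add (β β' : Γ.BoundarySpace 𝕜) (e : E) :
    Γ.leftValue (β + β') e = Γ.leftValue β e + Γ.leftValue β' e := by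
  unfold leftValue; split_ifs <;> simp

theorem rightValue_add (β β' : Γ.BoundarySpace 𝕜) (e : E) :
    Γ.rightValue (β + β') e = Γ.rightValue β e + Γ.rightValue β' e := by
  unfold rightValue; split_ifs <;> simp

theorem leftValue_smul (c : 𝕜) (β : Γ.BoundarySpace 𝕜) (e : E) :
    Γ.leftValue (c • β) e = c * Γ.leftValue β e := by
  unfold leftValue; split_ifs <;> simp

theorem rightValue_smul (c : 𝕜) (β : Γ.BoundarySpace 𝕜) (e : E) :
    Γ.rightValue (c • β) e = c * Γ.rightValue β e := by
  unfold rightValue; split_ifs <;> simp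

theorem hasSum_norm_leftValue_sq_add_norm_rightValue_sq (β : Γ.BoundarySpace 𝕜) :
    HasSum (fun e => ‖Γ.leftValue β e‖ ^ 2 + ‖Γ.rightValue β e‖ ^ 2) (‖β‖ ^ 2) := by
  have hβ : HasSum (fun p => ‖β p‖ ^ 2) (‖β‖ ^ 2) := by
    simpa using lp.hasSum_norm (p := 2) (by simp) β
  refine (Γ.hasSum_leftValue_add_rightValue hβ).congr_fun fun e => ?_
  unfold leftValue rightValue
  split_ifs <;> simp

/-- The function on the edge `e` which is `β (e, 0) ρ (x - aₑ)` near a finite left endpoint `aₑ` and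
`β (e, 1) σ (bₑ - x)` near a finite right endpoint `bₑ`, where `ρ` and `σ` are supported near
`0`. -/
noncomputable def edgeExtension (ρ σ : ℝ → ℝ) (β : Γ.BoundarySpace 𝕜) (e : E) :
    Lp 𝕜 2 (volume.restrict (Γ.edge e)) :=
  Γ.leftValue β e • toL2 𝕜 (Γ.edge e) (fun x => ρ (x - (Γ.a e).toReal)) +
    Γ.rightValue β e • toL2 𝕜 (Γ.edge e) (fun x => σ ((Γ.b e).toReal - x))

theorem norm_edgeExtension_sq_le (hρ : IsTestFunction s ρ) (hσ : IsTestFunction t σ)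
    (β : Γ.BoundarySpace 𝕜) (e : E) :
    ‖Γ.edgeExtension ρ σ β e‖ ^ 2 ≤ ((∫ x, ρ x ^ 2) + ∫ x, σ x ^ 2) *
      (‖Γ.leftValue β e‖ ^ 2 + ‖Γ.rightValue β e‖ ^ 2) := by
  have hleft := (hρ.comp_sub_const (Γ.a e).toReal).norm_toL2_sq_le (𝕜 := 𝕜) (I := Γ.edge e)
  have hright := (hσ.comp_const_sub (Γ.b e).toReal).norm_toL2_sq_le (𝕜 := 𝕜) (I := Γ.edge e)
  rw [integral_sub_right_eq_self (fun x => ρ x ^ 2)] at hleft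
  rw [integral_sub_left_eq_self (fun x => σ x ^ 2)] at hright
  rw [edgeExtension]
  set u := toL2 𝕜 (Γ.edge e) fun x => ρ (x - (Γ.a e).toReal)
  set v := toL2 𝕜 (Γ.edge e) fun x => σ ((Γ.b e).toReal - x)
  calc ‖Γ.leftValue β e • u + Γ.rightValue β e • v‖ ^ 2
      ≤ (‖u‖ * ‖Γ.leftValue β e‖ + ‖v‖ * ‖Γ.rightValue β e‖) ^ 2 := by
        gcongr
        exact (norm_add_le _ _).trans (by rw [norm_smul, norm_smul, mul_comm, mul_comm ‖v‖])
    _ ≤ (‖u‖ ^ 2 + ‖v‖ ^ 2) * (‖Γ.leftValue β e‖ ^ 2 + ‖Γ.rightValue β e‖ ^ 2) := by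
        nlinarith [sq_nonneg (‖u‖ * ‖Γ.rightValue β e‖ - ‖v‖ * ‖Γ.leftValue β e‖)]
    _ ≤ _ := by gcongr

theorem memℓp_edgeExtension (hρ : IsTestFunction s ρ) (hσ : IsTestFunction t σ)
    (β : Γ.BoundarySpace 𝕜) : Memℓp (Γ.edgeExtension ρ σ β) 2 := by
  have hsum : Summable fun e => ‖Γ.edgeExtension ρ σ β e‖ ^ 2 :=
    .of_nonneg_of_le (fun e => sq_nonneg _) (fun e => Γ.norm_edgeExtension_sq_le hρ hσ β e)
      ((Γ.hasSum_norm_leftValue_sq_add_norm_rightValue_sq β).summable.mul_left _)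
  exact memℓp_gen (by simpa using hsum)

/-- The bounded operator `ℓ₂(E') → ⨁ₑ L₂(aₑ, bₑ)` which is `edgeExtension ρ σ` on each edge. -/
noncomputable def extension (hρ : IsTestFunction s ρ) (hσ : IsTestFunction t σ) :
    Γ.BoundarySpace 𝕜 →L[𝕜] Γ.Space 𝕜 :=
  LinearMap.mkContinuous
    { toFun := fun β => ⟨Γ.edgeExtension ρ σ β, Γ.memℓp_edgeExtension hρ hσ β⟩
      map_add' := fun β β' => lp.ext <| funext fun e => by
        change Γ.edgeExtension ρ σ (β + β') e =
          Γ.edgeExtension ρ σ β e + Γ.edgeExtension ρ σ β' e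
        simp only [edgeExtension, leftValue_add, rightValue_add, add_smul]
        exact add_add_add_comm _ _ _ _
      map_smul' := fun c β => lp.ext <| funext fun e => by
        change Γ.edgeExtension ρ σ (c • β) e = c • Γ.edgeExtension ρ σ β e
        simp only [edgeExtension, leftValue_smul, rightValue_smul, mul_smul, smul_add] }
    √((∫ x, ρ x ^ 2) + ∫ x, σ x ^ 2) fun β => by
      set f : Γ.Space 𝕜 := ⟨Γ.edgeExtension ρ σ β, Γ.memℓp_edgeExtension hρ hσ β⟩
      have hf : HasSum (fun e => ‖Γ.edgeExtension ρ σ β e‖ ^ 2) (‖f‖ ^ 2) := by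
        simpa using lp.hasSum_norm (p := 2) (by simp) f
      have hle := hasSum_le (fun e => Γ.norm_edgeExtension_sq_le hρ hσ β e) hf
        ((Γ.hasSum_norm_leftValue_sq_add_norm_rightValue_sq β).mul_left _)
      rw [← Real.sqrt_sq (norm_nonneg β), ← Real.sqrt_mul' _ (sq_nonneg _)]
      exact Real.le_sqrt_of_sq_le hle

theorem extension_apply (hρ : IsTestFunction s ρ) (hσ : IsTestFunction t σ)
    (β : Γ.BoundarySpace 𝕜) (e : E) : Γ.extension hρ hσ β e = Γ.edgeExtension ρ σ β e := rfl

theorem hasWeakDeriv_extension (hρ : IsTestFunction s ρ) (hσ : IsTestFunction t σ)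
    (β : Γ.BoundarySpace 𝕜) :
    Γ.HasWeakDeriv (Γ.extension hρ hσ β) (Γ.extension hρ.deriv hσ.deriv.neg β) := fun e => by
  have hleft := (hρ.comp_sub_const (Γ.a e).toReal).isWeakDeriv_toL2 (𝕜 := 𝕜) (I := Γ.edge e)
  have hright := (hσ.comp_const_sub (Γ.b e).toReal).isWeakDeriv_toL2 (𝕜 := 𝕜) (I := Γ.edge e)
  rw [funext (deriv_comp_sub_const ρ _)] at hleft
  rw [funext (deriv_comp_const_sub σ _)] at hright
  exact (hleft.smul _).add (hright.smul _)

theorem boundaryValue_edgeExtension (hρ : IsTestFunction s ρ) (hσ : IsTestFunction t σ)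
    (β : Γ.BoundarySpace 𝕜) (e : E) {z : ℝ} (hz : z ∈ closure (Γ.edge e)) :
    boundaryValue (Γ.edge e) (Γ.edgeExtension ρ σ β e) z =
      Γ.leftValue β e * (ρ (z - (Γ.a e).toReal) : ℝ) +
        Γ.rightValue β e * (σ ((Γ.b e).toReal - z) : ℝ) := by
  have hI := Γ.isOpen_edge e
  have hc := Γ.ordConnected_edge e
  have hρ' := hρ.comp_sub_const (Γ.a e).toReal
  have hσ' := hσ.comp_const_sub (Γ.b e).toReal
  rw [edgeExtension, boundaryValue_add hI hc (hρ'.isWeakDeriv_toL2.smul _)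
      (hσ'.isWeakDeriv_toL2.smul _) hz, boundaryValue_smul hI hc _ hρ'.isWeakDeriv_toL2 hz,
    boundaryValue_smul hI hc _ hσ'.isWeakDeriv_toL2 hz, hρ'.boundaryValue_toL2 hI hz,
    hσ'.boundaryValue_toL2 hI hz]

variable {Γ} {r : ℝ}

theorem le_toReal_sub_toReal (hr : ∀ e, (r : EReal) ≤ Γ.b e - Γ.a e) {e : E} (ha : ⊥ < Γ.a e)
    (hb : Γ.b e < ⊤) : r ≤ (Γ.b e).toReal - (Γ.a e).toReal := by
  have hab := Γ.a_lt_b e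
  have hre := hr e
  lift Γ.a e to ℝ using ⟨hab.ne_top, ha.ne'⟩ with a
  lift Γ.b e to ℝ using ⟨hb.ne, hab.ne_bot⟩ with b
  exact_mod_cast hre

theorem boundaryValues_extension_inl (hr : ∀ e, (r : EReal) ≤ Γ.b e - Γ.a e)
    (hρ : IsTestFunction s ρ) (hσ : IsTestFunction (Ioo (-r) r) σ) (β : Γ.BoundarySpace 𝕜)
    (e : {e : E // ⊥ < Γ.a e}) :
    Γ.boundaryValues (Γ.extension hρ hσ β) (.inl e) = ρ 0 * β (.inl e) := by
  rw [boundaryValues, extension_apply,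
    Γ.boundaryValue_edgeExtension hρ hσ β e (left_mem_closure_edge e.2), sub_self, leftValue,
    dif_pos e.2, mul_comm, add_eq_left, rightValue]
  split_ifs with hb
  · rw [hσ.eq_zero fun h => h.2.not_ge (le_toReal_sub_toReal hr e.2 hb), RCLike.ofReal_zero,
      mul_zero]
  · exact zero_mul _

theorem boundaryValues_extension_inr (hr : ∀ e, (r : EReal) ≤ Γ.b e - Γ.a e)
    (hρ : IsTestFunction (Ioo (-r) r) ρ) (hσ : IsTestFunction t σ) (β : Γ.BoundarySpace 𝕜)
    (e : {e : E // Γ.b e < ⊤}) :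
    Γ.boundaryValues (Γ.extension hρ hσ β) (.inr e) = σ 0 * β (.inr e) := by
  rw [boundaryValues, extension_apply,
    Γ.boundaryValue_edgeExtension hρ hσ β e (right_mem_closure_edge e.2), sub_self, rightValue,
    dif_pos e.2, mul_comm _ (σ 0 : 𝕜), add_eq_right, leftValue]
  split_ifs with ha
  · rw [hρ.eq_zero fun h => h.2.not_ge (le_toReal_sub_toReal hr ha e.2), RCLike.ofReal_zero,
      mul_zero]
  · exact zero_mul _

end Extension

section MaximalLaplacian

variable {V E : Type*} {Γ : MetricGraph V E} {𝕜 : Type*} [RCLike 𝕜] {r : ℝ} {ρ : ℝ → ℝ}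

theorem HasWeakDeriv.exists_maximalLaplacian_eq_neg {f g h : Γ.Space 𝕜} (hfg : Γ.HasWeakDeriv f g)
    (hgh : Γ.HasWeakDeriv g h) :
    ∃ F : (Γ.maximalLaplacian 𝕜).domain, (F : Γ.Space 𝕜) = f ∧
      (Γ.firstDeriv F : Γ.Space 𝕜) = g ∧ Γ.maximalLaplacian 𝕜 F = -h := by
  have hg : Γ.weakDeriv ⟨f, g, hfg⟩ = g := (Γ.hasWeakDeriv_weakDeriv ⟨f, g, hfg⟩).unique hfg
  have hf : f ∈ Γ.W2 𝕜 := ⟨⟨f, g, hfg⟩,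
    show Γ.weakDeriv ⟨f, g, hfg⟩ ∈ Γ.W1 𝕜 from hg.symm ▸ ⟨h, hgh⟩, rfl⟩
  have hderiv : (Γ.firstDeriv ⟨f, hf⟩ : Γ.Space 𝕜) = g := hg
  exact ⟨⟨f, hf⟩, rfl, hderiv, congrArg Neg.neg <|
    (Γ.hasWeakDeriv_weakDeriv (Γ.firstDeriv ⟨f, hf⟩)).unique (hderiv ▸ hgh)⟩

theorem exists_trace_eq_and_signedTrace_eq (hΓ : 0 < ⨅ e, (Γ.b e - Γ.a e))
    (hr : ∀ e, (r : EReal) ≤ Γ.b e - Γ.a e) (hρ : IsTestFunction (Ioo (-r) r) ρ)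
    (β : Γ.BoundarySpace 𝕜) :
    ∃ F : (Γ.maximalLaplacian 𝕜).domain,
      Γ.trace hΓ (Γ.toW1 F) = ((ρ 0 : ℝ) : 𝕜) • β ∧
      Γ.signedTrace hΓ (Γ.firstDeriv F) = ((deriv ρ 0 : ℝ) : 𝕜) • β ∧
      (F : Γ.Space 𝕜) + Γ.maximalLaplacian 𝕜 F =
        Γ.extension hρ hρ β - Γ.extension hρ.deriv.deriv hρ.deriv.neg.deriv.neg β := by
  obtain ⟨F, hF, hF', hAF⟩ := (Γ.hasWeakDeriv_extension hρ hρ β).exists_maximalLaplacian_eq_neg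
    (Γ.hasWeakDeriv_extension hρ.deriv hρ.deriv.neg β)
  refine ⟨F, lp.ext (funext ?_), lp.ext (funext ?_), ?_⟩
  · rintro (e | e)
    · change Γ.boundaryValues (F : Γ.Space 𝕜) (.inl e) = _
      rw [hF, boundaryValues_extension_inl hr]
      rfl
    · change Γ.boundaryValues (F : Γ.Space 𝕜) (.inr e) = _
      rw [hF, boundaryValues_extension_inr hr]
      rfl
  · rintro (e | e)
    · change Γ.boundaryValues (Γ.firstDeriv F : Γ.Space 𝕜) (.inl e) = _
      rw [hF', boundaryValues_extension_inl hr]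
      rfl
    · change -Γ.boundaryValues (Γ.firstDeriv F : Γ.Space 𝕜) (.inr e) = _
      rw [hF', boundaryValues_extension_inr hr, Pi.neg_apply, RCLike.ofReal_neg, neg_mul, neg_neg]
      rfl
  · rw [hF, hAF, sub_eq_add_neg]

end MaximalLaplacian

end MetricGraph

/-! ### The Neumann problem -/

section WeakSolution

variable {𝕜 X Y : Type*} [RCLike 𝕜] [NormedAddCommGroup X] [InnerProductSpace 𝕜 X]
  [NormedAddCommGroup Y] [InnerProductSpace 𝕜 Y]

theorem exists_mem_forall_inner_snd_eq_inner_fst_sub (S : Submodule 𝕜 (WithLp 2 (X × Y)))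
    [S.HasOrthogonalProjection] (h : X) :
    ∃ p ∈ S, ∀ q ∈ S, ⟪q.snd, p.snd⟫_𝕜 = ⟪q.fst, h - p.fst⟫_𝕜 := by
  refine ⟨S.starProjection (WithLp.toLp 2 (h, 0)), S.starProjection_apply_mem _, fun q hq => ?_⟩
  have horth := S.sub_starProjection_mem_orthogonal (WithLp.toLp 2 (h, 0)) q hq
  rw [WithLp.prod_inner_apply, WithLp.ofLp_sub, Prod.fst_sub, Prod.snd_sub, zero_sub,
    inner_neg_right] at horth
  exact (sub_eq_zero.1 ((sub_eq_add_neg _ _).trans horth)).symm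

end WeakSolution

namespace MetricGraph

section Neumann

variable {V E : Type*} {Γ : MetricGraph V E} {𝕜 : Type*} [RCLike 𝕜]

theorem hasWeakDeriv_iff_inner_single [DecidableEq E] {f g : Γ.Space 𝕜} :
    Γ.HasWeakDeriv f g ↔ ∀ (e : E) (φ : ℝ → ℝ), IsTestFunction (Γ.edge e) φ →
      ⟪(lp.single 2 e (toL2 𝕜 (Γ.edge e) (deriv φ)) : Γ.Space 𝕜), f⟫_𝕜 =
        -⟪(lp.single 2 e (toL2 𝕜 (Γ.edge e) φ) : Γ.Space 𝕜), g⟫_𝕜 := by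
  simp only [lp.inner_single_left]
  exact forall_congr' fun e => isWeakDeriv_iff_inner_toL2

theorem hasWeakDeriv_single [DecidableEq E] {s : Set ℝ} {φ : ℝ → ℝ} (hφ : IsTestFunction s φ)
    (e : E) :
    Γ.HasWeakDeriv (lp.single 2 e (toL2 𝕜 (Γ.edge e) φ) : Γ.Space 𝕜)
      (lp.single 2 e (toL2 𝕜 (Γ.edge e) (deriv φ)) : Γ.Space 𝕜) := by
  intro e'
  obtain rfl | he := eq_or_ne e' e
  · rw [lp.single_apply_self, lp.single_apply_self]
    exact hφ.isWeakDeriv_toL2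
  · rw [lp.single_apply_ne _ _ _ he, lp.single_apply_ne _ _ _ he]
    exact isWeakDeriv_zero

variable (Γ 𝕜) in
/-- The graph of the weak derivative, with the Hilbert space structure of `W_2^1`. -/
noncomputable def derivGraph : Submodule 𝕜 (WithLp 2 (Γ.Space 𝕜 × Γ.Space 𝕜)) where
  carrier := {p | Γ.HasWeakDeriv p.fst p.snd}
  add_mem' h h' := h.add h'
  zero_mem' _ := isWeakDeriv_zero
  smul_mem' c _ h := h.smul c

theorem isClosed_derivGraph :
    IsClosed (Γ.derivGraph 𝕜 : Set (WithLp 2 (Γ.Space 𝕜 × Γ.Space 𝕜))) := by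
  classical
  have hset : (Γ.derivGraph 𝕜 : Set (WithLp 2 (Γ.Space 𝕜 × Γ.Space 𝕜))) =
      {p | Γ.HasWeakDeriv p.fst p.snd} := rfl
  simp_rw [hset, hasWeakDeriv_iff_inner_single, ofPred_forall]
  refine isClosed_iInter fun e => isClosed_iInter fun φ => isClosed_iInter fun _ =>
    isClosed_eq ?_ ?_
  · exact continuous_const.inner (WithLp.prod_continuous_ofLp 2 _ _).fst
  · exact (continuous_const.inner (WithLp.prod_continuous_ofLp 2 _ _).snd).neg

theorem exists_hasWeakDeriv_forall_inner_eq (h : Γ.Space 𝕜) :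
    ∃ f f' : Γ.Space 𝕜, Γ.HasWeakDeriv f f' ∧
      ∀ g g' : Γ.Space 𝕜, Γ.HasWeakDeriv g g' → ⟪g', f'⟫_𝕜 = ⟪g, h - f⟫_𝕜 := by
  have : CompleteSpace (Γ.derivGraph 𝕜) := isClosed_derivGraph.completeSpace_coe
  obtain ⟨p, hp, hpq⟩ := exists_mem_forall_inner_snd_eq_inner_fst_sub (Γ.derivGraph 𝕜) h
  exact ⟨p.fst, p.snd, hp, fun g g' hg => hpq (WithLp.toLp 2 (g, g')) hg⟩

theorem exists_neumann_solution (hΓ : 0 < ⨅ e, (Γ.b e - Γ.a e))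
    (htrace : Function.Surjective (Γ.trace (𝕜 := 𝕜) hΓ)) (h : Γ.Space 𝕜) :
    ∃ F : (Γ.maximalLaplacian 𝕜).domain, Γ.signedTrace hΓ (Γ.firstDeriv F) = 0 ∧
      (F : Γ.Space 𝕜) + Γ.maximalLaplacian 𝕜 F = h := by
  classical
  obtain ⟨f, f', hf, hweak⟩ := exists_hasWeakDeriv_forall_inner_eq h
  have hf' : Γ.HasWeakDeriv f' (f - h) := hasWeakDeriv_iff_inner_single.2 fun e φ hφ => by
    rw [hweak _ _ (hasWeakDeriv_single hφ e), ← inner_neg_right, neg_sub]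
  obtain ⟨F, hF, hF', hAF⟩ := hf.exists_maximalLaplacian_eq_neg hf'
  rw [neg_sub] at hAF
  refine ⟨F, ?_, by rw [hF, hAF, add_sub_cancel]⟩
  -- Testing with a `g` whose trace is `str f'` leaves only `‖str f'‖ ^ 2` in Green's identity.
  obtain ⟨g, hg⟩ := htrace (Γ.signedTrace hΓ (Γ.firstDeriv F))
  have hgreen := inner_maximalLaplacian_right hΓ g F
  rw [hAF, hF', hg, hweak _ _ (Γ.hasWeakDeriv_weakDeriv g), left_eq_add] at hgreen
  exact inner_self_eq_zero.1 hgreen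

end Neumann

theorem isBoundaryTriple {V E : Type*} {Γ : MetricGraph V E} {𝕜 : Type*} [RCLike 𝕜]
    (hΓ : 0 < ⨅ e, (Γ.b e - Γ.a e)) :
    IsBoundaryTriple (Γ.maximalLaplacian 𝕜) (Γ.trace hΓ ∘ₗ Γ.toW1)
      (Γ.signedTrace hΓ ∘ₗ Γ.firstDeriv) := by
  obtain ⟨r, hr, hlength⟩ := exists_length hΓ
  obtain ⟨ρ, hρ, hρ0, hρ1⟩ := exists_isTestFunction_eq_one_deriv_eq_zero hr
  -- `ρ` extends Dirichlet data and `x ↦ x ρ x` extends Neumann data.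
  have hσ := hρ.contDiff_mul contDiff_id
  have hσ1 : deriv (id * ρ) 0 = 1 := by
    simpa [hρ0] using ((hasDerivAt_id (0 : ℝ)).mul (hρ.hasDerivAt 0)).deriv
  have hdirichlet : ∀ β : Γ.BoundarySpace 𝕜, ∃ F : (Γ.maximalLaplacian 𝕜).domain,
      Γ.trace hΓ (Γ.toW1 F) = β ∧ Γ.signedTrace hΓ (Γ.firstDeriv F) = 0 ∧
        (F : Γ.Space 𝕜) + Γ.maximalLaplacian 𝕜 F =
          Γ.extension hρ hρ β - Γ.extension hρ.deriv.deriv hρ.deriv.neg.deriv.neg β := fun β => by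
    simpa only [hρ0, hρ1, RCLike.ofReal_one, RCLike.ofReal_zero, one_smul, zero_smul] using
      exists_trace_eq_and_signedTrace_eq hΓ hlength hρ β
  refine .of_neumann (greenIdentity_maximalLaplacian hΓ) (fun β => ?_)
    (exists_neumann_solution hΓ fun β => ?_)
    (Γ.extension hρ hρ - Γ.extension hρ.deriv.deriv hρ.deriv.neg.deriv.neg) hdirichlet
  · obtain ⟨F, -, hF, -⟩ := exists_trace_eq_and_signedTrace_eq hΓ hlength hσ β
    rw [hσ1, RCLike.ofReal_one, one_smul] at hF
    exact ⟨F, hF⟩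
  · obtain ⟨F, hF, -⟩ := hdirichlet β
    exact ⟨Γ.toW1 F, hF⟩

end MetricGraph

end QuantumGraph

theorem mainTheorem1 {𝕜 : Type*} [RCLike 𝕜] {V E : Type*} (Γ : QuantumGraph.MetricGraph V E)
    (hΓ : 0 < ⨅ e, (Γ.b e - Γ.a e))
    (H : Γ.Space 𝕜 →ₗ.[𝕜] Γ.Space 𝕜) (hH : H ≤ Γ.maximalLaplacian 𝕜) :
    IsSelfAdjoint H ↔
      ∃ (X : Submodule 𝕜 (Γ.BoundarySpace 𝕜)) (hX : IsClosed (X : Set (Γ.BoundarySpace 𝕜))),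
        haveI : CompleteSpace X := hX.completeSpace_coe
        ∃ L : X →ₗ.[𝕜] X, IsSelfAdjoint L ∧
          (H.domain : Set (Γ.Space 𝕜)) =
            {f | ∃ (hf : f ∈ (Γ.maximalLaplacian 𝕜).domain) (x : L.domain),
              ((x : X) : Γ.BoundarySpace 𝕜) = Γ.trace hΓ (Γ.toW1 ⟨f, hf⟩) ∧
              L x = X.orthogonalProjectionOnto (Γ.signedTrace hΓ (Γ.firstDeriv ⟨f, hf⟩))} :=
  (QuantumGraph.MetricGraph.isBoundaryTriple hΓ).isSelfAdjoint_iff_exists_operator hH
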